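/- **Setting.** Let $M$ be a compact metrizable space and $\Gamma\subset\mathsf{Homeo}(M)$ a (discrete) *convergence group*: for every sequence $(\gamma_n)$ of distinct elements of $\Gamma$ there are points $x,y\in M$ and a subsequence $(\gamma_{n_j})$ such that $\gamma_{n_j}|_{M\smallsetminus\{y\}}$ converges locally uniformly to the constant $x$. Assume $\Gamma$ is *non-elementary*: its limit set, i.e. the set of $x\in M$ for which there are $y\in M$ and a sequence $(\gamma_n)$ in $\Gamma$ with $\gamma_n|_{M\smallsetminus\{y\}}\to x$ locally uniformly, has at least three points. An element $\gamma\in\Gamma$ is *loxodromic* if it has two distinct fixed points $\gamma^+,\gamma^-$ in the limit set such that $\gamma^{\pm n}|_{M\smallsetminus\{\gamma^{\mp}\}}\to\gamma^{\pm}$ locally uniformly. A *compatible metric* is a metric $\mathrm d$ on $\Gamma\sqcup M$ whose topology is compact, induces the discrete topology on $\Gamma$ and the given topology on $M$, and for which $\Gamma$ (acting by left multiplication on $\Gamma$ and in the given way on $M$) acts on $\Gamma\sqcup M$ as a convergence group; the topology of such a metric is unique, so the notions below do not depend on the choice of $\mathrm d$. A function $\sigma:\Gamma\times M\to\mathbb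 R$ is a *coarse-cocycle* if for some $\kappa\ge 0$ one has $\limsup_{x\to x_0}|\sigma(\gamma,x_0)-\sigma(\gamma,x)|\le\kappa$ and $|\sigma(\gamma_1\gamma_2,x)-(\sigma(\gamma_1,\gamma_2x)+\sigma(\gamma_2,x))|\le\kappa$ for all $\gamma,\gamma_1,\gamma_2\in\Gamma$ and $x,x_0\in M$. It is *expanding* if * $\sigma(\gamma_n,\gamma_n^+)\to+\infty$ for every sequence $(\gamma_n)$ of distinct loxodromic elements with $\liminf_n \mathrm d(\gamma_n^-,\gamma_n^+)>0$, and * there is a function $\gamma\mapsto\|\gamma\|_\sigma\in\mathbb R$ on $\Gamma$ (a *$\sigma$-magnitude*) such that for every $\epsilon>0$ there is $C>0$ with $\|\gamma\|_\sigma-C\le\sigma(\gamma,x)\le\|\gamma\|_\sigma+C$ whenever $x\in M$, $\gamma\in\Gamma$ and $\mathrm d(x,\gamma^{-1})>\epsilon$. A Borel probability measure $\mu$ on $M$ is a *coarse $\sigma$-Patterson–Sullivan measure of dimension $\delta\in\mathbb R$* if there is a constant $C$ such that for every $\gamma\in\Gamma$ the measures $\gamma_*\mu$ and $\mu$ are mutually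 absolutely continuous and $$e^{-C-\delta\sigma(\gamma^{-1},\cdot)}\le\frac{d\gamma_*\mu}{d\mu}\le e^{C-\delta\sigma(\gamma^{-1},\cdot)}\qquad\mu\text{-almost everywhere}.$$ **Proposition.** Let $\sigma_1,\sigma_2:\Gamma\times M\to\mathbb R$ be expanding coarse-cocycles with magnitudes $\|\cdot\|_{\sigma_1},\|\cdot\|_{\sigma_2}$, and for $i=1,2$ let $\mu_i$ be a coarse $\sigma_i$-Patterson–Sullivan measure of dimension $\delta_i$. Suppose $$\sum_{\gamma\in\Gamma}e^{-\delta_1\|\gamma\|_{\sigma_1}}=+\infty .$$ Then exactly one of the following holds: $\mu_1\perp\mu_2$; or $\mu_1\ll\mu_2$ and $\mu_2\ll\mu_1$. Moreover, the following are equivalent: 1. $\mu_1\ll\mu_2$; 2. $\mu_1\ll\mu_2$ and $\mu_2\ll\mu_1$; 3. $\sup_{\gamma\in\Gamma}\bigl|\delta_1\|\gamma\|_{\sigma_1}-\delta_2\|\gamma\|_{\sigma_2}\bigr|<+\infty$; 4. there is $C>0$ with $C^{-1}\mu_1\le\mu_2\le C\mu_1$. -/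

import Mathlib

open Filter Topology MeasureTheory Set
open scoped ENNReal NNReal

noncomputable section

namespace CoarsePS

/-- `f n` restricted to `X \ {y}` converges locally uniformly to the constant map with value `x`,
for a sequence of self-maps of a compact Hausdorff space `X`: the convergence is uniform on every
compact subset of the (locally compact) space `X \ {y}`. -/
def ConvergesOffPoint {X : Type*} [TopologicalSpace X] (f : ℕ → X → X) (y x : X) : Prop :=
  ∀ K : Set X, IsCompact K → y ∉ K → ∀ U ∈ 𝓝 x, ∀ᶠ n in atTop, MapsTo (f n) K U

/-- The maps `act g`, `g : G`, form a convergence group: they are continuous, and every sequence of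
distinct elements has a subsequence which, away from one point, converges locally uniformly to a
point. (It is only used for faithful actions of groups.) -/
def ActsAsConvergenceGroup {G X : Type*} [TopologicalSpace X] (act : G → X → X) : Prop :=
  (∀ g, Continuous (act g)) ∧
  ∀ s : ℕ → G, Function.Injective s →
    ∃ x y : X, ∃ φ : ℕ → ℕ, StrictMono φ ∧ ConvergesOffPoint (fun n => act (s (φ n))) y x

section Basic

variable {M : Type*} [TopologicalSpace M]

/-- The tautological action of a group of homeomorphisms. -/
def homeoAct (Γ : Subgroup (M ≃ₜ M)) (γ : Γ) (x : M) : M := (γ : M ≃ₜ M) x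

/-- A (discrete) convergence group on `M`. -/
def IsConvergenceGroup (Γ : Subgroup (M ≃ₜ M)) : Prop :=
  ActsAsConvergenceGroup (homeoAct Γ)

/-- The limit set `Λ(Γ)`. -/
def limitSet (Γ : Subgroup (M ≃ₜ M)) : Set M :=
  {x | ∃ y : M, ∃ s : ℕ → Γ, ConvergesOffPoint (fun n => homeoAct Γ (s n)) y x}

/-- `Γ` is non-elementary: its limit set has at least three points. -/
def IsNonElementary (Γ : Subgroup (M ≃ₜ M)) : Prop :=
  3 ≤ (limitSet Γ).encard

/-- `γ` is loxodromic with attracting fixed point `a` and repelling fixed point `b`. (Both points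
then lie in the limit set, by definition of the limit set.) -/
def IsLoxodromic (Γ : Subgroup (M ≃ₜ M)) (γ : Γ) (a b : M) : Prop :=
  a ≠ b ∧ homeoAct Γ γ a = a ∧ homeoAct Γ γ b = b ∧
  ConvergesOffPoint (fun n => homeoAct Γ (γ ^ n)) b a ∧
  ConvergesOffPoint (fun n => homeoAct Γ (γ⁻¹ ^ n)) a b

/-- The set `Γ ⊔ M`. It is a type synonym, so that it does not carry the topology of a disjoint
union. -/
def Bordification (Γ : Subgroup (M ≃ₜ M)) : Type _ := Γ ⊕ M

/-- The inclusion `Γ ↪ Γ ⊔ M`. -/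
def ofGroup (Γ : Subgroup (M ≃ₜ M)) (γ : Γ) : Bordification Γ := Sum.inl γ

/-- The inclusion `M ↪ Γ ⊔ M`. -/
def ofPoint (Γ : Subgroup (M ≃ₜ M)) (x : M) : Bordification Γ := Sum.inr x

/-- The natural action of `Γ` on `Γ ⊔ M`: left multiplication on `Γ`, and the given action
on `M`. -/
def bordAct (Γ : Subgroup (M ≃ₜ M)) (γ : Γ) : Bordification Γ → Bordification Γ :=
  Sum.map (fun α : Γ => γ * α) (homeoAct Γ γ)

/-- Compactifying topologies on `Γ ⊔ M`. -/
structure IsCompactifyingTopology (Γ : Subgroup (M ≃ₜ M))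
    (t : TopologicalSpace (Bordification Γ)) : Prop where
  compact : @CompactSpace (Bordification Γ) t
  metrizable : @TopologicalSpace.MetrizableSpace (Bordification Γ) t
  isEmbedding_ofGroup : @IsEmbedding Γ (Bordification Γ) ⊥ t (ofGroup Γ)
  isEmbedding_ofPoint : @IsEmbedding M (Bordification Γ) _ t (ofPoint Γ)
  convergence : @ActsAsConvergenceGroup Γ (Bordification Γ) t (bordAct Γ)

/-- A metric on `Γ ⊔ M` is compatible if it induces a compactifying topology. -/
def IsCompatibleMetric (Γ : Subgroup (M ≃ₜ M)) (d : MetricSpace (Bordification Γ)) : Prop :=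
  IsCompactifyingTopology Γ d.toUniformSpace.toTopologicalSpace

/-- `σ` is a `κ`-coarse-cocycle. The first condition says
`limsup_{x → x₀} |σ(γ, x₀) - σ(γ, x)| ≤ κ`. -/
structure IsCoarseCocycleWith (Γ : Subgroup (M ≃ₜ M)) (κ : ℝ) (σ : Γ → M → ℝ) : Prop where
  coarselyContinuous : ∀ (γ : Γ) (x₀ : M), ∀ ε > 0, ∀ᶠ x in 𝓝 x₀, |σ γ x₀ - σ γ x| < κ + ε
  cocycle : ∀ (γ₁ γ₂ : Γ) (x : M),
    |σ (γ₁ * γ₂) x - (σ γ₁ (homeoAct Γ γ₂ x) + σ γ₂ x)| ≤ κ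

/-- `σ` is a coarse-cocycle. -/
def IsCoarseCocycle (Γ : Subgroup (M ≃ₜ M)) (σ : Γ → M → ℝ) : Prop :=
  ∃ κ : ℝ, 0 ≤ κ ∧ IsCoarseCocycleWith Γ κ σ

/-- Properness of `σ`, with respect to the metric `d` on `Γ ⊔ M`: `σ(γₙ, γₙ⁺) → +∞` for every
sequence of distinct loxodromic elements with `liminf d(γₙ⁻, γₙ⁺) > 0`. -/
def IsProperFor (Γ : Subgroup (M ≃ₜ M)) (d : MetricSpace (Bordification Γ))
    (σ : Γ → M → ℝ) : Prop :=
  ∀ (γ : ℕ → Γ) (a b : ℕ → M), Function.Injective γ → (∀ n, IsLoxodromic Γ (γ n) (a n) (b n)) →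
    (∃ c > 0, ∀ᶠ n in atTop, c ≤ d.dist (ofPoint Γ (b n)) (ofPoint Γ (a n))) →
    Tendsto (fun n => σ (γ n) (a n)) atTop atTop

/-- The magnitude property of a function `N` on `Γ`, with respect to the metric `d`
on `Γ ⊔ M`. -/
def IsMagnitudeFor (Γ : Subgroup (M ≃ₜ M)) (d : MetricSpace (Bordification Γ))
    (σ : Γ → M → ℝ) (N : Γ → ℝ) : Prop :=
  ∀ ε > 0, ∃ C > 0, ∀ (x : M) (γ : Γ), ε < d.dist (ofPoint Γ x) (ofGroup Γ γ⁻¹) →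
    N γ - C ≤ σ γ x ∧ σ γ x ≤ N γ + C

/-- `N` is a `σ`-magnitude `γ ↦ ‖γ‖_σ`. The choice of the compatible metric is immaterial, as
compatible metrics on `Γ ⊔ M` are uniformly equivalent. -/
def IsMagnitude (Γ : Subgroup (M ≃ₜ M)) (σ : Γ → M → ℝ) (N : Γ → ℝ) : Prop :=
  ∃ d : MetricSpace (Bordification Γ), IsCompatibleMetric Γ d ∧ IsMagnitudeFor Γ d σ N

/-- `σ` is an expanding coarse-cocycle. The choice of the compatible metric is immaterial, as
compatible metrics on `Γ ⊔ M` are uniformly equivalent. -/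
def IsExpanding (Γ : Subgroup (M ≃ₜ M)) (σ : Γ → M → ℝ) : Prop :=
  IsCoarseCocycle Γ σ ∧
  ∃ d : MetricSpace (Bordification Γ), IsCompatibleMetric Γ d ∧ IsProperFor Γ d σ ∧
    ∃ N : Γ → ℝ, IsMagnitudeFor Γ d σ N

/-- The Poincaré series `∑_γ exp (-s ‖γ‖) ∈ [0, ∞]` of a magnitude function. -/
def poincareSeries (Γ : Subgroup (M ≃ₜ M)) (N : Γ → ℝ) (s : ℝ) : ℝ≥0∞ :=
  ∑' γ : Γ, ENNReal.ofReal (Real.exp (-s * N γ))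

variable [MeasurableSpace M]

/-- `μ` is a `C`-coarse `σ`-Patterson–Sullivan measure of dimension `δ`. -/
structure IsPattersonSullivanWith (Γ : Subgroup (M ≃ₜ M)) (C : ℝ) (σ : Γ → M → ℝ) (δ : ℝ)
    (μ : Measure M) : Prop where
  isProbabilityMeasure : IsProbabilityMeasure μ
  map_ac : ∀ γ : Γ, μ.map (homeoAct Γ γ) ≪ μ
  ac_map : ∀ γ : Γ, μ ≪ μ.map (homeoAct Γ γ)
  rnDeriv_bounds : ∀ γ : Γ, ∀ᵐ x ∂μ,
    ENNReal.ofReal (Real.exp (-C - δ * σ γ⁻¹ x)) ≤ (μ.map (homeoAct Γ γ)).rnDeriv μ x ∧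
    (μ.map (homeoAct Γ γ)).rnDeriv μ x ≤ ENNReal.ofReal (Real.exp (C - δ * σ γ⁻¹ x))

/-- `μ` is a coarse `σ`-Patterson–Sullivan measure of dimension `δ`. -/
def IsCoarsePattersonSullivan (Γ : Subgroup (M ≃ₜ M)) (σ : Γ → M → ℝ) (δ : ℝ)
    (μ : Measure M) : Prop :=
  ∃ C : ℝ, IsPattersonSullivanWith Γ C σ δ μ

end Basic

end CoarsePS

end

open CoarsePS

open CoarsePS

set_option linter.unusedSectionVars false

/-! ### Convergence dynamics on a compactification, via ultrafilter limits -/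

namespace ConvBord

/-! Work in the compactification Γ ⊔ M with base point o = 1, and call the g-image of the points of
M far from g⁻¹o the shadow of g. On far points σᵢ(g, ·) is Nᵢ(g) up to a bounded error, so g scales
μᵢ there by about exp(-δᵢNᵢ(g)). Since Γ fixes no point of M, far sets carry a definite mass, and
shadows of a small fixed parameter have μᵢ-mass about exp(-δᵢNᵢ(g)): the shadow lemma. Comparable
measures thus have comparable weights.

The geometry rests on N₁ being proper (`IsConvBord.isProperMagnitude`). If the shadows of a and b
meet and N₁(a) is not much larger than N₁(b), then N₁(b) is N₁(a) + N₁(a⁻¹b) up to a constant, and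
the shadow of b lies in a slightly larger shadow of a (`exists_additive`, `exists_shadow_subset`).
Hence a Vitali covering lemma holds, and with it a density theorem for shadows; covering null sets
also turns comparable weights into absolute continuity (`IsProperMagnitude.absolutelyContinuous`).

Coarse additivity makes shadows almost independent, so by Kochen–Stone divergence forces a positive
measure of points lying in infinitely many shadows. Applied to the restriction of μ₁ to the
complement of the invariant conical set, this shows that μ₁ lives on that set
(`measure_compl_conicalSet`).

Finally, suppose that μ₁ and μ₂ are not mutually singular. They are comparable on some conical set E
of positive measure. Zooming in at a density point of E by elements g, the sets g⁻¹E fill M away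
from one point b, and there the two measures are comparable up to the ratio of the weights of g.
Comparison on one fixed set bounds this ratio, and a translation moving b removes the exceptional
point (`IsProperMagnitude.exists_le_smul`, used in both directions). -/

/-- A compact metric `G`-space `B` in which the orbit of `o` accumulates only on the image of the
equivariant map `p : M → B`, and on which `G` acts as a convergence group. -/
structure IsConvBord {G M B : Type*} [Group G] [MulAction G M] [MulAction G B]
    [TopologicalSpace M] [MetricSpace B] (p : M → B) (o : B) : Prop where
  continuous : Continuous p
  injective : Function.Injective p
  map_smul : ∀ (g : G) (x : M), p (g • x) = g • p x
  base_notMem : o ∉ range p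
  contract : ∀ ε > 0, ∀ᶠ g : G in cofinite, ∀ z : B, ε ≤ dist z (g⁻¹ • o) →
    dist (g • z) (g • o) < ε
  accumulate : ∀ ε > 0, ∀ᶠ g : G in cofinite, ∃ x : M, dist (g • o) (p x) < ε

/-- Stands in for passing to subsequences: along an ultrafilter, either the elements stabilize or
the convergence dynamics apply. -/
theorem ultrafilter_eventually_eq_or_tendsto {ι α : Type*} (𝒰 : Ultrafilter ι) (g : ι → α) :
    (∃ a, ∀ᶠ i in (𝒰 : Filter ι), g i = a) ∨ Tendsto g 𝒰 cofinite := by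
  rcases (𝒰.map g).le_cofinite_or_eq_pure with h | ⟨a, h⟩
  · exact Or.inr h
  · left
    refine ⟨a, ?_⟩
    have : ({a} : Set α) ∈ (𝒰.map g) := by rw [h]; simp
    exact this

theorem ultrafilter_exists_tendsto {ι X : Type*} [TopologicalSpace X] [CompactSpace X]
    (𝒰 : Ultrafilter ι) (z : ι → X) : ∃ x, Tendsto z 𝒰 (𝓝 x) :=
  ⟨(𝒰.map z).lim, (𝒰.map z).le_nhds_lim⟩

theorem tendsto_inv_cofinite {ι G : Type*} [Group G] {F : Filter ι} {g : ι → G}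
    (h : Tendsto g F cofinite) : Tendsto (fun i => (g i)⁻¹) F cofinite :=
  (inv_injective.tendsto_cofinite).comp h

theorem tendsto_mul_left_cofinite {ι G : Type*} [Group G] {F : Filter ι} {g : ι → G} (a : G)
    (h : Tendsto g F cofinite) : Tendsto (fun i => a * g i) F cofinite :=
  ((mul_right_injective a).tendsto_cofinite).comp h

theorem tendsto_mul_smul_base {ι G B : Type*} [Group G] [MulAction G B] [TopologicalSpace B]
    [ContinuousConstSMul G B] {F : Filter ι} {g : ι → G} {x o : B} (a : G)
    (hx : Tendsto (fun i => g i • o) F (𝓝 x)) :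
    Tendsto (fun i => (a * g i) • o) F (𝓝 (a • x)) := by
  have := ((continuous_const_smul a).tendsto x).comp hx
  refine this.congr fun i => ?_
  simp [mul_smul]

section
variable {G M B : Type*} [Group G] [MulAction G M] [MulAction G B]
  [TopologicalSpace M] [CompactSpace M] [MetricSpace B] [CompactSpace B]
  [ContinuousConstSMul G B] {p : M → B} {o : B}

namespace IsConvBord

variable (h : IsConvBord (G := G) p o)
include h

theorem isClosedEmbedding : IsClosedEmbedding p := h.continuous.isClosedEmbedding h.injective

theorem isClosed_range : IsClosed (range p) := h.isClosedEmbedding.isClosed_range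

theorem t2Space : T2Space M := h.isClosedEmbedding.isEmbedding.t2Space

theorem smul_base_ne (g : G) (x : M) : g • o ≠ p x := by
  intro hg
  apply h.base_notMem
  refine ⟨g⁻¹ • x, ?_⟩
  rw [h.map_smul, ← hg, inv_smul_smul]

theorem continuousConstSMul : ContinuousConstSMul G M := by
  refine ⟨fun g => ?_⟩
  rw [h.isClosedEmbedding.isEmbedding.continuous_iff]
  have : p ∘ (fun x => g • x) = fun x => g • p x := by
    ext x; exact h.map_smul g x
  rw [this]
  exact h.continuous.const_smul g

theorem exists_dist_base_ge (g : G) : ∃ ε > 0, ∀ x : M, ε < dist (p x) (g • o) := by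
  have h1 : g • o ∈ (range p)ᶜ := by
    rintro ⟨x, hx⟩
    exact h.smul_base_ne g x hx.symm
  obtain ⟨ε, hε, hb⟩ := Metric.isOpen_iff.1 h.isClosed_range.isOpen_compl _ h1
  refine ⟨ε / 2, by positivity, fun x => ?_⟩
  by_contra! hlt
  exact hb (Metric.mem_ball.2 (lt_of_le_of_lt hlt (by linarith))) ⟨x, rfl⟩

/-- North–south dynamics with a moving argument: away from the repelling limit y of (g i)⁻¹ • o,
`contract` keeps g i • z i close to g i • o. -/
theorem tendsto_smul {ι : Type*} {F : Filter ι} {g : ι → G} {z : ι → B} {x y z₀ : B}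
    (hg : Tendsto g F cofinite) (hx : Tendsto (fun i => g i • o) F (𝓝 x))
    (hy : Tendsto (fun i => (g i)⁻¹ • o) F (𝓝 y)) (hz : Tendsto z F (𝓝 z₀)) (hne : z₀ ≠ y) :
    Tendsto (fun i => g i • z i) F (𝓝 x) := by
  rw [Metric.tendsto_nhds]
  intro ε hε
  set r := min (ε / 2) (dist z₀ y / 2) with hr
  have hd : 0 < dist z₀ y := dist_pos.2 hne
  have hr0 : 0 < r := by positivity
  filter_upwards [hg.eventually (h.contract r hr0), Metric.tendsto_nhds.1 hx (ε / 2) (by positivity),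
    (hz.dist hy).eventually (lt_mem_nhds (show r < dist z₀ y by
      have := min_le_right (ε / 2) (dist z₀ y / 2); linarith))] with i h1 h2 h3
  have h4 := h1 (z i) h3.le
  have := min_le_left (ε / 2) (dist z₀ y / 2)
  have := dist_triangle (g i • z i) (g i • o) x
  linarith

theorem exists_tendsto_base {ι : Type*} {𝒰 : Ultrafilter ι} {g : ι → G}
    (hg : Tendsto g 𝒰 cofinite) : ∃ x : M, Tendsto (fun i => g i • o) 𝒰 (𝓝 (p x)) := by
  obtain ⟨x, hx⟩ := ultrafilter_exists_tendsto 𝒰 (fun i => g i • o)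
  have hx' : x ∈ range p := by
    rw [← h.isClosed_range.closure_eq, Metric.mem_closure_iff]
    intro ε hε
    obtain ⟨i, ⟨m, hm⟩, h2⟩ := ((hg.eventually (h.accumulate (ε / 2) (by positivity))).and
      (Metric.tendsto_nhds.1 hx (ε / 2) (by positivity))).exists
    refine ⟨p m, ⟨m, rfl⟩, ?_⟩
    have := dist_triangle x (g i • o) (p m)
    rw [dist_comm] at h2
    linarith
  obtain ⟨m, rfl⟩ := hx'
  exact ⟨m, hx⟩

theorem tendsto_smul_point {ι : Type*} {F : Filter ι} {g : ι → G} {z : ι → M} {x y z₀ : M}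
    (hg : Tendsto g F cofinite) (hx : Tendsto (fun i => g i • o) F (𝓝 (p x)))
    (hy : Tendsto (fun i => (g i)⁻¹ • o) F (𝓝 (p y))) (hz : Tendsto z F (𝓝 z₀)) (hne : z₀ ≠ y) :
    Tendsto (fun i => g i • z i) F (𝓝 x) := by
  rw [h.isClosedEmbedding.isEmbedding.tendsto_nhds_iff]
  have := h.tendsto_smul hg hx hy ((h.continuous.tendsto z₀).comp hz) (h.injective.ne hne)
  refine this.congr fun i => ?_
  simp [h.map_smul]

/-- Right translations do not move the limit in the boundary. -/
theorem tendsto_mul_right_base {ι : Type*} {𝒰 : Ultrafilter ι} {g : ι → G} {x : B} (a : G)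
    (hg : Tendsto g 𝒰 cofinite) (hx : Tendsto (fun i => g i • o) 𝒰 (𝓝 x)) :
    Tendsto (fun i => (g i * a) • o) 𝒰 (𝓝 x) := by
  obtain ⟨y, hy⟩ := h.exists_tendsto_base (tendsto_inv_cofinite hg)
  have := h.tendsto_smul hg hx hy (tendsto_const_nhds (x := a • o)) (h.smul_base_ne a y)
  refine this.congr fun i => ?_
  simp [mul_smul]

/-- By `accumulate`, only finitely many group elements have their orbit point at distance at least
1/(n+1) from M, and every orbit point has positive distance from the closed set M. -/
theorem countable : Countable G := by
  choose ε hε hd using h.exists_dist_base_ge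
  have : (univ : Set G) = ⋃ n : ℕ, {g : G | ¬ ∃ x : M, dist (g • o) (p x) < 1 / ((n : ℝ) + 1)} := by
    symm
    rw [eq_univ_iff_forall]
    intro g
    obtain ⟨n, hn⟩ := exists_nat_one_div_lt (hε g)
    refine mem_iUnion.2 ⟨n, ?_⟩
    rintro ⟨x, hx⟩
    have := hd g x
    rw [dist_comm] at this
    linarith
  rw [← countable_univ_iff, this]
  refine countable_iUnion fun n => ?_
  exact (Filter.eventually_cofinite.1 (h.accumulate (1 / ((n : ℝ) + 1)) (by positivity))).countable

theorem convergesOffPoint {g : ℕ → G} {x y : M} (hg : Tendsto g atTop cofinite)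
    (hx : Tendsto (fun n => g n • o) atTop (𝓝 (p x)))
    (hy : Tendsto (fun n => (g n)⁻¹ • o) atTop (𝓝 (p y))) :
    ConvergesOffPoint (fun n (z : M) => g n • z) y x := by
  intro K hK hyK U hU
  by_contra hcon
  have hcon : ∃ᶠ n in atTop, ¬ MapsTo (fun z : M => g n • z) K U := not_eventually.1 hcon
  obtain ⟨𝒰, h𝒰, hbad⟩ : ∃ 𝒰 : Ultrafilter ℕ, (𝒰 : Filter ℕ) ≤ atTop ∧
      ∀ᶠ n in (𝒰 : Filter ℕ), ¬ MapsTo (fun z : M => g n • z) K U := by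
    have := Filter.frequently_iff_neBot.1 hcon
    refine ⟨@Ultrafilter.of _ _ this, (Ultrafilter.of_le _).trans inf_le_left, ?_⟩
    exact (Ultrafilter.of_le _).trans inf_le_right (mem_principal_self _)
  have : ∀ n, ∃ z : M, ¬ MapsTo (fun z : M => g n • z) K U → z ∈ K ∧ g n • z ∉ U := by
    intro n
    by_cases hn : MapsTo (fun z : M => g n • z) K U
    · exact ⟨x, fun h => absurd hn h⟩
    · simp only [MapsTo, not_forall] at hn
      obtain ⟨z, hz, hz'⟩ := hn
      exact ⟨z, fun _ => ⟨hz, hz'⟩⟩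
  choose z hz using this
  obtain ⟨z₀, hz₀⟩ := ultrafilter_exists_tendsto 𝒰 z
  have := h.t2Space
  have hz₀K : z₀ ∈ K := hK.isClosed.mem_of_tendsto hz₀ (hbad.mono fun n hn => (hz n hn).1)
  have := h.tendsto_smul_point (hg.mono_left h𝒰) (hx.mono_left h𝒰) (hy.mono_left h𝒰) hz₀
    (fun he => hyK (he ▸ hz₀K))
  obtain ⟨n, hn1, hn2⟩ := ((this.eventually hU).and hbad).exists
  exact (hz n hn2).2 hn1

end IsConvBord
end

theorem hyperfilter_nat_le_atTop : (hyperfilter ℕ : Filter ℕ) ≤ atTop := by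
  rw [← Nat.cofinite_eq_atTop]; exact hyperfilter_le_cofinite

theorem eventually_hyperfilter_one_div_lt {r : ℝ} (hr : 0 < r) :
    ∀ᶠ n : ℕ in (hyperfilter ℕ : Filter ℕ), 1 / ((n : ℝ) + 1) < r :=
  hyperfilter_nat_le_atTop (tendsto_one_div_add_atTop_nhds_zero_nat.eventually (gt_mem_nhds hr))

/-! ### Shadows: coarse additivity, Vitali covering, conical limit set -/

section
variable {G M B : Type*} [Group G] [MulAction G M] [MulAction G B]
  [TopologicalSpace M] [CompactSpace M] [MetricSpace B] [CompactSpace B]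
  [ContinuousConstSMul G B]

/-- The points of `M` which are `ε`-far from `g⁻¹ • o`. -/
def farSet (p : M → B) (o : B) (ε : ℝ) (g : G) : Set M := {x | ε < dist (p x) (g⁻¹ • o)}

/-- The shadow of `g`: the image under `g` of the points which are `ε`-far from `g⁻¹ • o`. -/
def shadow (p : M → B) (o : B) (ε : ℝ) (g : G) : Set M :=
  {x | ε < dist (p (g⁻¹ • x)) (g⁻¹ • o)}

/-- The points of `M` lying in infinitely many `ε`-shadows. -/
def radialSet (G : Type*) {M B : Type*} [Group G] [MulAction G M] [MulAction G B] [MetricSpace B]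
    (p : M → B) (o : B) (ε : ℝ) : Set M := {x | ∃ᶠ g : G in cofinite, x ∈ shadow p o ε g}

/-- The conical limit set. -/
def conicalSet (G : Type*) {M B : Type*} [Group G] [MulAction G M] [MulAction G B] [MetricSpace B]
    (p : M → B) (o : B) : Set M := {x | ∃ ε > 0, x ∈ radialSet G p o ε}

/-- `σ` satisfies the coarse cocycle identity, and `N` is a proper magnitude for it. -/
structure IsProperMagnitude (p : M → B) (o : B) (σ : G → M → ℝ) (N : G → ℝ) : Prop where
  cocycle : ∃ κ : ℝ, ∀ (g h : G) (x : M), |σ (g * h) x - (σ g (h • x) + σ h x)| ≤ κ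
  magnitude : ∀ ε > 0, ∃ C : ℝ, ∀ (x : M) (g : G), ε < dist (p x) (g⁻¹ • o) → |σ g x - N g| ≤ C
  proper : Tendsto N cofinite atTop

variable {p : M → B} {o : B} {σ : G → M → ℝ} {N : G → ℝ}

theorem farSet_anti {ε ε' : ℝ} (hε : ε' ≤ ε) (g : G) : farSet p o ε g ⊆ farSet p o ε' g :=
  fun _ hx => lt_of_le_of_lt hε hx

theorem shadow_anti {ε ε' : ℝ} (hε : ε' ≤ ε) (g : G) : shadow p o ε g ⊆ shadow p o ε' g :=
  fun _ hx => lt_of_le_of_lt hε hx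

theorem radialSet_anti {ε ε' : ℝ} (hε : ε' ≤ ε) : radialSet G p o ε ⊆ radialSet G p o ε' :=
  fun _ hx => hx.mono fun g hg => shadow_anti hε g hg

theorem IsProperMagnitude.exists_lowerBound (hN : IsProperMagnitude p o σ N) :
    ∃ c : ℝ, ∀ g, c ≤ N g := by
  have hfin : {g | ¬ (0 ≤ N g)}.Finite :=
    Filter.eventually_cofinite.1 (hN.proper.eventually (eventually_ge_atTop 0))
  obtain ⟨c, hc⟩ := (hfin.image N).bddBelow
  refine ⟨min c 0, fun g => ?_⟩
  by_cases hg : 0 ≤ N g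
  · exact (min_le_right _ _).trans hg
  · exact (min_le_left _ _).trans (hc ⟨g, hg, rfl⟩)

theorem IsProperMagnitude.finite_le (hN : IsProperMagnitude p o σ N) (R : ℝ) :
    {g | N g ≤ R}.Finite := by
  have := Filter.eventually_cofinite.1 (hN.proper.eventually (eventually_gt_atTop R))
  simpa using this

variable (h : IsConvBord (G := G) p o)
include h

theorem IsConvBord.isOpen_farSet (ε : ℝ) (g : G) : IsOpen (farSet p o ε g) :=
  isOpen_lt continuous_const (h.continuous.dist continuous_const)

theorem IsConvBord.isOpen_shadow (ε : ℝ) (g : G) : IsOpen (shadow p o ε g) := by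
  have := h.continuousConstSMul
  exact isOpen_lt continuous_const
    ((h.continuous.comp (continuous_const_smul g⁻¹)).dist continuous_const)

/-- If the shadows of `a` and `b` intersect, and the magnitude of `a` is not much larger than that
of `b`, then the corresponding point is far from `(a⁻¹ * b)⁻¹`. -/
theorem IsProperMagnitude.exists_lt_dist (hN : IsProperMagnitude p o σ N) {ε : ℝ} (hε : 0 < ε)
    (R : ℝ) : ∃ ε' > 0, ∀ (a b : G) (x : M), x ∈ shadow p o ε a → x ∈ shadow p o ε b →
      N a ≤ N b + R → ε' < dist (p (b⁻¹ • x)) ((a⁻¹ * b)⁻¹ • o) := by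
  -- For a sequence of counterexamples, g = a⁻¹b escapes and g⁻¹ • o has the same limit as b⁻¹ • x.
  -- The latter stays away from b⁻¹ • o, so a⁻¹ • o = g • b⁻¹ • o has the same limit as g • o, and
  -- a⁻¹ • x is far from it. The cocycle identity for a = b g⁻¹ then makes N(a) - N(b) comparable to
  -- N(g⁻¹), which tends to infinity.
  by_contra! hcon
  choose a b x ha hb hab hd using fun n : ℕ => hcon (1 / ((n : ℝ) + 1)) (by positivity)
  let 𝒰 := hyperfilter ℕ
  let g := fun n => (a n)⁻¹ * b n
  obtain ⟨u, hu⟩ := ultrafilter_exists_tendsto 𝒰 (fun n => (b n)⁻¹ • x n)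
  obtain ⟨s, hs⟩ := ultrafilter_exists_tendsto 𝒰 (fun n => (a n)⁻¹ • x n)
  obtain ⟨β, hβ⟩ := ultrafilter_exists_tendsto 𝒰 (fun n => (b n)⁻¹ • o)
  have hpu := (h.continuous.tendsto u).comp hu
  have hps := (h.continuous.tendsto s).comp hs
  have hgu : Tendsto (fun n => (g n)⁻¹ • o) 𝒰 (𝓝 (p u)) := by
    rw [Metric.tendsto_nhds]
    intro r hr
    filter_upwards [Metric.tendsto_nhds.1 hpu (r / 2) (by positivity),
      eventually_hyperfilter_one_div_lt (show 0 < r / 2 by positivity)] with n h1 h2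
    have h3 := hd n
    have := dist_triangle ((g n)⁻¹ • o) (p ((b n)⁻¹ • x n)) (p u)
    rw [dist_comm] at h3
    simp only [Function.comp] at h1
    linarith
  have hg : Tendsto g 𝒰 cofinite := by
    rcases ultrafilter_eventually_eq_or_tendsto 𝒰 g with ⟨g₀, hg₀⟩ | hg
    · exfalso
      have : Tendsto (fun n => (g n)⁻¹ • o) 𝒰 (𝓝 (g₀⁻¹ • o)) :=
        tendsto_const_nhds.congr' (hg₀.mono fun n hn => by simp [hn])
      exact h.smul_base_ne _ _ (tendsto_nhds_unique this hgu)
    · exact hg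
  obtain ⟨y, hy⟩ := h.exists_tendsto_base hg
  have hβu : ε ≤ dist (p u) β := ge_of_tendsto (hpu.dist hβ) (Eventually.of_forall fun n => (hb n).le)
  have ha' : Tendsto (fun n => (a n)⁻¹ • o) 𝒰 (𝓝 (p y)) := by
    have := h.tendsto_smul hg hy hgu hβ (by rintro rfl; simp at hβu; linarith)
    refine this.congr fun n => ?_
    simp [g, mul_smul]
  have hsy : ε ≤ dist (p s) (p y) :=
    ge_of_tendsto (hps.dist ha') (Eventually.of_forall fun n => (ha n).le)
  obtain ⟨κ, hκ⟩ := hN.cocycle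
  obtain ⟨C₁, hC₁⟩ := hN.magnitude ε hε
  obtain ⟨C₂, hC₂⟩ := hN.magnitude (ε / 2) (by positivity)
  have hfar : ∀ᶠ n in (𝒰 : Filter ℕ), ε / 2 < dist (p ((a n)⁻¹ • x n)) (g n • o) :=
    (hps.dist hy).eventually (lt_mem_nhds (by linarith))
  obtain ⟨n, hn1, hn2⟩ := (hfar.and ((hN.proper.comp (tendsto_inv_cofinite hg)).eventually
    (eventually_gt_atTop (R + κ + C₁ + C₁ + C₂)))).exists
  have e1 := abs_le.1 (hC₁ _ _ (ha n))
  have e2 := abs_le.1 (hC₁ _ _ (hb n))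
  have e3 := abs_le.1 (hC₂ ((a n)⁻¹ • x n) (g n)⁻¹ (by simpa using hn1))
  have e4 := abs_le.1 (hκ (b n) (g n)⁻¹ ((a n)⁻¹ • x n))
  have e5 : b n * (g n)⁻¹ = a n := by simp [g]
  have e6 : (g n)⁻¹ • (a n)⁻¹ • x n = (b n)⁻¹ • x n := by simp [g, mul_smul]
  rw [e5, e6] at e4
  have := hab n
  simp only [Function.comp] at hn2
  linarith [e1.1, e1.2, e2.1, e2.2, e3.1, e3.2, e4.1, e4.2]

/-- Apply the cocycle identity to b = a(a⁻¹b) at b⁻¹ • x, where x is a common point of the shadows.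
All three values of σ are taken at far points, the one for a⁻¹b thanks to `exists_lt_dist`, so each
can be replaced by N. -/
theorem IsProperMagnitude.exists_additive (hN : IsProperMagnitude p o σ N) {ε : ℝ} (hε : 0 < ε)
    (R : ℝ) : ∃ C : ℝ, ∀ (a b : G), (shadow p o ε a ∩ shadow p o ε b).Nonempty →
      N a ≤ N b + R → |N b - N a - N (a⁻¹ * b)| ≤ C := by
  obtain ⟨ε', hε', hd⟩ := hN.exists_lt_dist h hε R
  obtain ⟨κ, hκ⟩ := hN.cocycle
  obtain ⟨C₁, hC₁⟩ := hN.magnitude ε hε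
  obtain ⟨C₂, hC₂⟩ := hN.magnitude ε' hε'
  refine ⟨κ + C₁ + C₁ + C₂, fun a b ⟨x, hxa, hxb⟩ hab => ?_⟩
  have e1 := abs_le.1 (hC₁ _ _ hxa)
  have e2 := abs_le.1 (hC₁ _ _ hxb)
  have e3 := abs_le.1 (hC₂ _ _ (hd a b x hxa hxb hab))
  have e4 := abs_le.1 (hκ a (a⁻¹ * b) (b⁻¹ • x))
  rw [mul_inv_cancel_left, mul_smul, smul_inv_smul] at e4
  rw [abs_le]
  constructor <;> linarith [e1.1, e1.2, e2.1, e2.2, e3.1, e3.2, e4.1, e4.2]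

/-- This is the engulfing property behind the Vitali lemma: shadows with a smaller parameter play
the role of enlarged balls. -/
theorem IsProperMagnitude.exists_shadow_subset (hN : IsProperMagnitude p o σ N) {ε : ℝ}
    (hε : 0 < ε) (R : ℝ) : ∃ ε' > 0, ∀ (a b : G), (shadow p o ε a ∩ shadow p o ε b).Nonempty →
      N a ≤ N b + R → shadow p o ε b ⊆ shadow p o ε' a := by
  obtain ⟨ε₁, hε₁, hd₁⟩ := hN.exists_lt_dist h hε R
  by_contra! hcon
  simp only [not_subset] at hcon
  choose a b hne hab w hwb hwa using fun n : ℕ => hcon (1 / ((n : ℝ) + 1)) (by positivity)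
  choose x hxa hxb using hne
  let 𝒰 := hyperfilter ℕ
  let g := fun n => (a n)⁻¹ * b n
  obtain ⟨u, hu⟩ := ultrafilter_exists_tendsto 𝒰 (fun n => (b n)⁻¹ • x n)
  obtain ⟨s, hs⟩ := ultrafilter_exists_tendsto 𝒰 (fun n => (a n)⁻¹ • x n)
  obtain ⟨v, hv⟩ := ultrafilter_exists_tendsto 𝒰 (fun n => (b n)⁻¹ • w n)
  obtain ⟨t, ht⟩ := ultrafilter_exists_tendsto 𝒰 (fun n => (a n)⁻¹ • w n)
  obtain ⟨β, hβ⟩ := ultrafilter_exists_tendsto 𝒰 (fun n => (b n)⁻¹ • o)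
  have hpu := (h.continuous.tendsto u).comp hu
  have hps := (h.continuous.tendsto s).comp hs
  have hpv := (h.continuous.tendsto v).comp hv
  have hpt := (h.continuous.tendsto t).comp ht
  have hat : Tendsto (fun n => (a n)⁻¹ • o) 𝒰 (𝓝 (p t)) := by
    rw [Metric.tendsto_nhds]
    intro r hr
    filter_upwards [Metric.tendsto_nhds.1 hpt (r / 2) (by positivity),
      eventually_hyperfilter_one_div_lt (show 0 < r / 2 by positivity)] with n h1 h2
    have h3' : ¬ (1 / ((n : ℝ) + 1) < dist (p ((a n)⁻¹ • w n)) ((a n)⁻¹ • o)) := hwa n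
    have h3 := not_lt.1 h3'
    have := dist_triangle ((a n)⁻¹ • o) (p ((a n)⁻¹ • w n)) (p t)
    rw [dist_comm] at h3
    simp only [Function.comp] at h1
    linarith
  have hβv : ε ≤ dist (p v) β :=
    ge_of_tendsto (hpv.dist hβ) (Eventually.of_forall fun n => (hwb n).le)
  have hst : ε ≤ dist (p s) (p t) :=
    ge_of_tendsto (hps.dist hat) (Eventually.of_forall fun n => (hxa n).le)
  -- A constant g carries the limits of b⁻¹ • o and b⁻¹ • w, which are ε-apart, to the common limit
  -- p t. If g escapes, then a⁻¹ • x tends to its attracting point y, so t ≠ y. This forces b⁻¹ • o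
  -- towards the repelling point z, hence b⁻¹ • w away from z, and a⁻¹ • w tends to y after all.
  rcases ultrafilter_eventually_eq_or_tendsto 𝒰 g with ⟨g₀, hg₀⟩ | hg
  · have h1 : Tendsto (fun n => (a n)⁻¹ • o) 𝒰 (𝓝 (g₀ • β)) := by
      refine (((continuous_const_smul g₀).tendsto β).comp hβ).congr' (hg₀.mono fun n hn => ?_)
      simp [← hn, g, mul_smul]
    have h2 : Tendsto (fun n => p ((a n)⁻¹ • w n)) 𝒰 (𝓝 (g₀ • p v)) := by
      refine (((continuous_const_smul g₀).tendsto (p v)).comp hpv).congr' (hg₀.mono fun n hn => ?_)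
      simp [← hn, g, mul_smul, h.map_smul]
    have h3 := (tendsto_nhds_unique h1 hat).trans (tendsto_nhds_unique hpt h2)
    have h4 := (MulAction.injective g₀) h3
    rw [h4, dist_self] at hβv
    linarith
  · obtain ⟨y, hy⟩ := h.exists_tendsto_base hg
    obtain ⟨z, hz⟩ := h.exists_tendsto_base (tendsto_inv_cofinite hg)
    have huz : ε₁ ≤ dist (p u) (p z) := ge_of_tendsto (hpu.dist hz)
      (Eventually.of_forall fun n => (hd₁ _ _ _ (hxa n) (hxb n) (hab n)).le)
    have hsy : s = y := by
      have huz' : u ≠ z := by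
        rintro rfl
        rw [dist_self] at huz
        linarith
      have := h.t2Space
      refine tendsto_nhds_unique hs ((h.tendsto_smul_point hg hy hz hu huz').congr fun n => ?_)
      simp [g, mul_smul]
    have hty : t ≠ y := by
      rintro rfl
      rw [hsy, dist_self] at hst
      linarith
    have hβz : β = p z := by
      by_contra hne
      have := h.tendsto_smul hg hy hz hβ hne
      refine hty (h.injective (tendsto_nhds_unique hat (this.congr fun n => ?_)))
      simp [g, mul_smul]
    have hvz : v ≠ z := by
      rintro rfl
      rw [hβz, dist_self] at hβv
      linarith
    have := h.tendsto_smul hg hy hz hpv (h.injective.ne hvz)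
    refine hty (h.injective (tendsto_nhds_unique hpt (this.congr fun n => ?_)))
    simp [g, mul_smul, h.map_smul]

theorem IsConvBord.eventually_shadow_dist_lt {ε r : ℝ} (hε : 0 < ε) (hr : 0 < r) :
    ∀ᶠ g : G in cofinite, ∀ x ∈ shadow p o ε g, dist (p x) (g • o) < r := by
  filter_upwards [h.contract (min ε r) (lt_min hε hr)] with g hg x hx
  have := hg (p (g⁻¹ • x)) ((min_le_left _ _).trans hx.le)
  rw [← h.map_smul, smul_inv_smul] at this
  exact this.trans_le (min_le_right _ _)

/-- A Vitali covering lemma for shadows. -/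
theorem IsProperMagnitude.exists_disjoint_shadows (hN : IsProperMagnitude p o σ N) {ε : ℝ}
    (hε : 0 < ε) : ∃ ε' > 0, ∀ (T : Set G) (U X : Set M), IsOpen U → X ⊆ U →
      (∀ x ∈ X, ∃ᶠ g : G in cofinite, g ∈ T ∧ x ∈ shadow p o ε g) →
      ∃ u ⊆ T, u.PairwiseDisjoint (shadow p o ε) ∧ (∀ g ∈ u, shadow p o ε g ⊆ U) ∧
        X ⊆ ⋃ g ∈ u, shadow p o ε' g := by
  -- With sizes exp(-N) and Vitali ratio 2, the selected element b satisfies N b ≤ N g + log 2.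
  obtain ⟨ε', hε', hsub⟩ := hN.exists_shadow_subset h hε (Real.log 2)
  refine ⟨ε', hε', fun T U X hU hXU hX => ?_⟩
  obtain ⟨c, hc⟩ := hN.exists_lowerBound
  obtain ⟨u, hut, hdisj, hcov⟩ := Vitali.exists_disjoint_subfamily_covering_enlargement
    (shadow (G := G) p o ε) {g | g ∈ T ∧ (shadow p o ε g).Nonempty ∧ shadow p o ε g ⊆ U}
    (fun g => Real.exp (-N g)) 2 (by norm_num) (fun _ _ => (Real.exp_pos _).le) (Real.exp (-c))
    (fun g _ => Real.exp_le_exp.2 (neg_le_neg (hc g))) (fun g hg => hg.2.1)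
  refine ⟨u, fun g hg => (hut hg).1, hdisj, fun g hg => (hut hg).2.2, fun x hx => ?_⟩
  obtain ⟨r, hr, hball⟩ : ∃ r > 0, ∀ y, dist (p y) (p x) < r → y ∈ U := by
    have : U ∈ comap p (𝓝 (p x)) := by
      rw [← h.isClosedEmbedding.isEmbedding.nhds_eq_comap]; exact hU.mem_nhds (hXU hx)
    obtain ⟨r, hr, hb⟩ := (Metric.nhds_basis_ball.comap p).mem_iff.1 this
    exact ⟨r, hr, fun y hy => hb hy⟩
  obtain ⟨g, ⟨hgT, hxg⟩, hg⟩ := ((hX x hx).and_eventually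
    (h.eventually_shadow_dist_lt hε (show 0 < r / 2 by positivity))).exists
  have hgU : shadow p o ε g ⊆ U := fun y hy => hball y <| by
    have h1 := hg y hy
    have h2 := hg x hxg
    have := dist_triangle_right (p y) (p x) (g • o)
    linarith
  obtain ⟨b, hbu, hne, hle⟩ := hcov g ⟨hgT, ⟨x, hxg⟩, hgU⟩
  refine mem_iUnion₂.2 ⟨b, hbu, hsub b g (by rwa [inter_comm]) ?_ hxg⟩
  have h3 : Real.exp (-N g) ≤ Real.exp (Real.log 2 + -N b) := by
    rw [Real.exp_add, Real.exp_log (by norm_num)]; exact hle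
  have := Real.exp_le_exp.1 h3
  linarith

/-- The conical limit set is invariant. -/
theorem IsConvBord.smul_mem_conicalSet {x : M} (a : G) (hx : x ∈ conicalSet G p o) :
    a • x ∈ conicalSet G p o := by
  obtain ⟨ε, hε, hx⟩ := hx
  refine ⟨ε / 2, by positivity, ?_⟩
  -- Repelling points of g and a * g merge: a⁻¹ • o keeps a positive distance from almost all orbit
  -- points, so `contract` for g⁻¹ brings its image close to g⁻¹ • o.
  have h1 : ∀ᶠ g : G in cofinite, dist ((g⁻¹ * a⁻¹) • o) (g⁻¹ • o) < ε / 2 := by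
    obtain ⟨r, hr, hd⟩ := h.exists_dist_base_ge a⁻¹
    have hr' : 0 < min (r / 2) (ε / 2) := by positivity
    have h2 : ∀ᶠ g : G in cofinite, min (r / 2) (ε / 2) ≤ dist (a⁻¹ • o) (g • o) := by
      filter_upwards [h.accumulate (r / 2) (by positivity)] with g ⟨m, hm⟩
      have := hd m
      have := dist_triangle (p m) (g • o) (a⁻¹ • o)
      rw [dist_comm] at hm
      rw [dist_comm (g • o)] at this
      have := min_le_left (r / 2) (ε / 2)
      linarith
    filter_upwards [(tendsto_inv_cofinite tendsto_id).eventually (h.contract _ hr'), h2] with g hg hg2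
    have := hg (a⁻¹ • o) (by simpa using hg2)
    rw [mul_smul]
    exact this.trans_le (min_le_right _ _)
  have h3 : ∃ᶠ g : G in cofinite, a • x ∈ shadow p o (ε / 2) (a * g) := by
    refine (hx.and_eventually h1).mono fun g ⟨hg, hg'⟩ => ?_
    have hg : ε < dist (p (g⁻¹ • x)) (g⁻¹ • o) := hg
    show ε / 2 < dist (p ((a * g)⁻¹ • a • x)) ((a * g)⁻¹ • o)
    rw [mul_inv_rev, mul_smul g⁻¹ a⁻¹ (a • x), inv_smul_smul]
    have := dist_triangle (p (g⁻¹ • x)) ((g⁻¹ * a⁻¹) • o) (g⁻¹ • o)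
    linarith
  exact (tendsto_mul_left_cofinite a tendsto_id).frequently h3

theorem IsConvBord.measurableSet_radialSet [MeasurableSpace M] [BorelSpace M] (ε : ℝ) :
    MeasurableSet (radialSet G p o ε) := by
  have := h.countable
  have : radialSet G p o ε = ⋂ F : Finset G, ⋃ g : {g : G // g ∉ F}, shadow p o ε g.1 := by
    ext x
    simp only [radialSet, mem_ofPred_eq, mem_iInter, mem_iUnion, Subtype.exists]
    rw [Filter.hasBasis_cofinite.frequently_iff]
    constructor
    · intro H F
      obtain ⟨g, hg, hx⟩ := H _ F.finite_toSet
      exact ⟨g, by simpa using hg, hx⟩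
    · intro H F hF
      obtain ⟨g, hg, hx⟩ := H hF.toFinset
      exact ⟨g, by simpa using hg, hx⟩
  rw [this]
  exact .iInter fun F => .iUnion fun g => (h.isOpen_shadow ε g.1).measurableSet

theorem IsConvBord.conicalSet_eq_iUnion :
    conicalSet G p o = ⋃ n : ℕ, radialSet G p o (1 / ((n : ℝ) + 1)) := by
  ext x
  simp only [conicalSet, mem_ofPred_eq, mem_iUnion]
  constructor
  · rintro ⟨ε, hε, hx⟩
    obtain ⟨n, hn⟩ := exists_nat_one_div_lt hε
    exact ⟨n, radialSet_anti hn.le hx⟩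
  · rintro ⟨n, hx⟩
    exact ⟨_, by positivity, hx⟩

theorem IsConvBord.measurableSet_conicalSet [MeasurableSpace M] [BorelSpace M] :
    MeasurableSet (conicalSet G p o) := by
  rw [h.conicalSet_eq_iUnion]
  exact .iUnion fun n => h.measurableSet_radialSet _

end
-- Shadow conformal measures: shadow lemma, density points, absolute continuity
section
variable {G M B : Type*} [Group G] [MulAction G M] [MulAction G B]
  [TopologicalSpace M] [CompactSpace M] [MetricSpace B] [CompactSpace B]
  [ContinuousConstSMul G B] [MeasurableSpace M] [BorelSpace M]

/-- Each `g` scales the measure `μ` by a factor comparable to `w g` away from `g⁻¹ • o`. -/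
structure IsShadowConformal (p : M → B) (o : B) (w : G → ℝ≥0) (μ : Measure M) : Prop where
  pos : ∀ g, 0 < w g
  scale : ∀ ε > 0, ∃ C : ℝ≥0, ∀ (g : G) (A : Set M), MeasurableSet A → A ⊆ farSet p o ε g →
    μ ((fun x => g⁻¹ • x) ⁻¹' A) ≤ C * w g * μ A ∧
    w g * μ A ≤ C * μ ((fun x => g⁻¹ • x) ⁻¹' A)

variable {p : M → B} {o : B} {σ : G → M → ℝ} {N : G → ℝ} {w w₁ w₂ : G → ℝ≥0} {μ ν : Measure M}

variable (h : IsConvBord (G := G) p o)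
include h

theorem IsConvBord.measurable_smul (g : G) : Measurable fun x : M => g • x := by
  have := h.continuousConstSMul
  exact (continuous_const_smul g).measurable

/-- For a single g no restriction to a far set is needed, since all of M has positive distance from
g • o. -/
theorem IsShadowConformal.exists_measure_preimage_le (hμ : IsShadowConformal p o w μ) (g : G) :
    ∃ C : ℝ≥0, ∀ A : Set M, MeasurableSet A → μ ((fun x => g • x) ⁻¹' A) ≤ C * μ A := by
  obtain ⟨ε, hε, hd⟩ := h.exists_dist_base_ge g
  obtain ⟨C, hC⟩ := hμ.scale ε hε
  refine ⟨C * w g⁻¹, fun A hA => ?_⟩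
  have := (hC g⁻¹ A hA (fun x _ => by simpa [farSet] using hd x)).1
  simpa using this

theorem IsShadowConformal.exists_measure_le_preimage (hμ : IsShadowConformal p o w μ) (g : G) :
    ∃ C : ℝ≥0, ∀ A : Set M, MeasurableSet A → μ A ≤ C * μ ((fun x => g • x) ⁻¹' A) := by
  obtain ⟨C, hC⟩ := hμ.exists_measure_preimage_le h g⁻¹
  refine ⟨C, fun A hA => ?_⟩
  have := hC _ (h.measurable_smul g hA)
  rwa [← preimage_comp, show (fun x : M => g • x) ∘ (fun x => g⁻¹ • x) = id by ext; simp,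
    preimage_id] at this

/-- A measure concentrated on z gives no mass to a • z, so by quasi-invariance none to z either. -/
theorem IsShadowConformal.measure_compl_singleton_ne_zero (hμ : IsShadowConformal p o w μ)
    (hμ0 : μ ≠ 0) {a : G} {z : M} (ha : a • z ≠ z) : μ {z}ᶜ ≠ 0 := by
  intro h0
  have := h.t2Space
  obtain ⟨C, hC⟩ := hμ.exists_measure_preimage_le h a
  have h1 : μ ((fun x => a • x) ⁻¹' {a • z}) = 0 := by
    refine le_antisymm ((hC _ (measurableSet_singleton _)).trans ?_) bot_le
    rw [measure_mono_null (show {a • z} ⊆ ({z} : Set M)ᶜ by simpa using fun e => ha e.symm) h0]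
    simp
  have h2 : μ {z} = 0 := measure_mono_null (by simp) h1
  apply hμ0
  rw [← Measure.measure_univ_eq_zero, ← union_compl_self {z}]
  exact measure_union_null h2 h0

/-- If far sets could have arbitrarily small measure at arbitrarily small scales, μ would vanish off
a limit β of the points g⁻¹ • o. No nonzero quasi-invariant measure is concentrated on one point of
M when that point is moved. -/
theorem IsShadowConformal.exists_le_measure_farSet [IsFiniteMeasure μ]
    (hμ : IsShadowConformal p o w μ) (hμ0 : μ ≠ 0) (hfix : ∀ x : M, ∃ a : G, a • x ≠ x) :
    ∃ ε > 0, ∃ c : ℝ≥0, 0 < c ∧ ∀ g : G, c ≤ μ (farSet p o ε g) := by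
  by_contra! hcon
  choose g hg using fun n : ℕ => hcon (1 / ((n : ℝ) + 1)) (by positivity)
    (1 / ((n : ℝ≥0) + 1)) (by positivity)
  obtain ⟨β, hβ⟩ := ultrafilter_exists_tendsto (hyperfilter ℕ) (fun n => (g n)⁻¹ • o)
  have key : ∀ r > 0, μ {x | r < dist (p x) β} = 0 := by
    intro r hr
    by_contra hne
    have hlim : Tendsto (fun n : ℕ => ((1 / ((n : ℝ≥0) + 1) : ℝ≥0) : ℝ≥0∞)) atTop (𝓝 0) := by
      rw [← ENNReal.coe_zero, ENNReal.tendsto_coe]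
      exact tendsto_one_div_add_atTop_nhds_zero_nat
    have h1 : ∀ᶠ n : ℕ in (hyperfilter ℕ : Filter ℕ), ((1 / ((n : ℝ≥0) + 1) : ℝ≥0) : ℝ≥0∞) <
        μ {x | r < dist (p x) β} := hyperfilter_nat_le_atTop (hlim.eventually (gt_mem_nhds (pos_iff_ne_zero.2 hne)))
    obtain ⟨n, ⟨hn1, hn2⟩, hn3⟩ := ((h1.and (eventually_hyperfilter_one_div_lt
      (show 0 < r / 2 by positivity))).and
      (Metric.tendsto_nhds.1 hβ (r / 2) (by positivity))).exists
    refine absurd ((measure_mono fun x hx => ?_).trans_lt ((hg n).trans hn1)) (lt_irrefl _)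
    have hx : r < dist (p x) β := hx
    have := dist_triangle (p x) ((g n)⁻¹ • o) β
    show _ < dist (p x) ((g n)⁻¹ • o)
    linarith
  have key2 : μ {x | p x ≠ β} = 0 := by
    refine measure_mono_null (t := ⋃ n : ℕ, {x | 1 / ((n : ℝ) + 1) < dist (p x) β}) ?_
      (measure_iUnion_null fun n => key _ (by positivity))
    intro x hx
    obtain ⟨n, hn⟩ := exists_nat_one_div_lt (dist_pos.2 hx)
    exact mem_iUnion.2 ⟨n, hn⟩
  by_cases hβr : β ∈ range p
  · obtain ⟨z, rfl⟩ := hβr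
    obtain ⟨a, ha⟩ := hfix z
    refine hμ.measure_compl_singleton_ne_zero h hμ0 ha (measure_mono_null (fun x hx => ?_) key2)
    exact h.injective.ne hx
  · apply hμ0
    rw [← Measure.measure_univ_eq_zero]
    exact measure_mono_null (fun x _ he => hβr ⟨x, he⟩) key2

theorem IsShadowConformal.exists_measure_shadow_le [IsFiniteMeasure μ]
    (hμ : IsShadowConformal p o w μ) {ε : ℝ} (hε : 0 < ε) :
    ∃ C : ℝ≥0, ∀ g : G, μ (shadow p o ε g) ≤ C * w g := by
  obtain ⟨C, hC⟩ := hμ.scale ε hε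
  refine ⟨C * (μ univ).toNNReal, fun g => ?_⟩
  refine ((hC g _ (h.isOpen_farSet ε g).measurableSet subset_rfl).1).trans ?_
  rw [ENNReal.coe_mul, ENNReal.coe_toNNReal (measure_ne_top _ _), mul_right_comm]
  gcongr
  exact subset_univ _

/-- The shadow lemma. -/
theorem IsShadowConformal.exists_le_measure_shadow [IsFiniteMeasure μ]
    (hμ : IsShadowConformal p o w μ) (hμ0 : μ ≠ 0) (hfix : ∀ x : M, ∃ a : G, a • x ≠ x) :
    ∃ ε₀ > 0, ∀ ε > 0, ε ≤ ε₀ → ∃ C : ℝ≥0, ∀ g : G, w g ≤ C * μ (shadow p o ε g) := by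
  obtain ⟨ε₀, hε₀, c, hc, hcμ⟩ := hμ.exists_le_measure_farSet h hμ0 hfix
  refine ⟨ε₀, hε₀, fun ε hε hεε₀ => ?_⟩
  obtain ⟨C, hC⟩ := hμ.scale ε hε
  refine ⟨c⁻¹ * C, fun g => ?_⟩
  have h1 := (hC g _ (h.isOpen_farSet ε g).measurableSet subset_rfl).2
  have h2 : (c : ℝ≥0∞) ≤ μ (farSet p o ε g) := (hcμ g).trans (measure_mono (farSet_anti hεε₀ g))
  calc (w g : ℝ≥0∞) = (c⁻¹ : ℝ≥0) * (w g * c) := by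
        norm_cast
        field_simp
    _ ≤ (c⁻¹ : ℝ≥0) * (C * μ (shadow p o ε g)) := by
        refine mul_le_mul_right ?_ _
        exact (by gcongr : (w g : ℝ≥0∞) * c ≤ w g * μ (farSet p o ε g)).trans h1
    _ = _ := by push_cast; ring

theorem tsum_measure_le_of_pairwiseDisjoint {u : Set G} {s : G → Set M} {U : Set M}
    (hs : ∀ g, MeasurableSet (s g)) (hu : u.PairwiseDisjoint s) (hU : ∀ g ∈ u, s g ⊆ U) :
    ∑' g : u, μ (s g) ≤ μ U := by
  have := h.countable
  rw [← measure_biUnion (to_countable u) hu fun g _ => hs g]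
  exact measure_mono (iUnion₂_subset hU)

/-- Almost every point of `E` is a density point of `E` with respect to shadows. -/
theorem IsProperMagnitude.measure_inter_frequently_eq_zero [IsFiniteMeasure ν] [ν.OuterRegular]
    (hN : IsProperMagnitude p o σ N) (hν : IsShadowConformal p o w ν) {ε : ℝ} (hε : 0 < ε)
    {C₀ : ℝ≥0} (hC₀ : ∀ g : G, w g ≤ C₀ * ν (shadow p o ε g)) {E : Set M} (hE : MeasurableSet E)
    {η : ℝ≥0} (hη : 0 < η) :
    ν (E ∩ {x | ∃ᶠ g : G in cofinite, η * ν (shadow p o ε g) ≤ ν (shadow p o ε g \ E) ∧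
      x ∈ shadow p o ε g}) = 0 := by
  have := h.countable
  set X := E ∩ {x | ∃ᶠ g : G in cofinite, η * ν (shadow p o ε g) ≤ ν (shadow p o ε g \ E) ∧
      x ∈ shadow p o ε g} with hX
  obtain ⟨ε', hε', hV⟩ := hN.exists_disjoint_shadows h hε
  obtain ⟨C₁, hC₁⟩ := hν.exists_measure_shadow_le h hε'
  have key : ∀ δ : ℝ≥0, 0 < δ → η * ν X ≤ (C₁ * C₀ : ℝ≥0) * δ := by
    intro δ hδ
    obtain ⟨U, hXU, hU, hUδ⟩ := X.exists_isOpen_lt_add (μ := ν) (measure_ne_top _ _)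
      (ENNReal.coe_ne_zero.2 hδ.ne')
    obtain ⟨u, huT, hudisj, huU, hXu⟩ := hV {g | η * ν (shadow p o ε g) ≤ ν (shadow p o ε g \ E)}
      U X hU hXU (fun x hx => hx.2)
    -- The set X lies in E and nearly exhausts U, so little room is left outside E. Yet each
    -- selected shadow has an η-fraction outside E, and their enlargements cover X.
    have h1 : ν (U \ E) ≤ δ := by
      have h2 := measure_inter_add_sdiff (μ := ν) U hE
      have h3 : ν X ≤ ν (U ∩ E) := measure_mono fun x hx => ⟨hXU hx, hx.1⟩
      have h4 : ν X + ν (U \ E) ≤ ν X + δ := (add_le_add_left h3 _).trans (h2.le.trans hUδ.le)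
      exact (ENNReal.add_le_add_iff_left (measure_ne_top _ _)).1 h4
    calc η * ν X ≤ η * ∑' g : u, ν (shadow p o ε' (g : G)) := by
          gcongr
          exact (measure_mono hXu).trans (measure_biUnion_le _ (to_countable u) _)
      _ = ∑' g : u, η * ν (shadow p o ε' (g : G)) := ENNReal.tsum_mul_left.symm
      _ ≤ ∑' g : u, (C₁ * C₀ : ℝ≥0) * ν (shadow p o ε (g : G) \ E) := by
          refine ENNReal.tsum_le_tsum fun g => ?_
          calc η * ν (shadow p o ε' (g : G)) ≤ η * (C₁ * (C₀ * ν (shadow p o ε (g : G)))) := by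
                gcongr
                exact (hC₁ g).trans (by gcongr; exact hC₀ g)
            _ = (C₁ * C₀ : ℝ≥0) * (η * ν (shadow p o ε (g : G))) := by push_cast; ring
            _ ≤ _ := by gcongr; exact huT g.2
      _ = (C₁ * C₀ : ℝ≥0) * ∑' g : u, ν (shadow p o ε (g : G) \ E) := ENNReal.tsum_mul_left
      _ ≤ (C₁ * C₀ : ℝ≥0) * ν (U \ E) := by
          gcongr
          exact tsum_measure_le_of_pairwiseDisjoint h
            (fun g => (h.isOpen_shadow ε g).measurableSet.diff hE)
            (hudisj.mono fun g => sdiff_subset) (fun g hg => sdiff_subset_sdiff_left (huU g hg))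
      _ ≤ _ := by gcongr
  have h0 : η * ν X = 0 := by
    by_contra hne
    have hfin : η * ν X ≠ ∞ := ENNReal.mul_ne_top ENNReal.coe_ne_top (measure_ne_top _ _)
    lift (η * ν X) to ℝ≥0 using hfin with t ht
    have htpos : 0 < t := by
      rw [pos_iff_ne_zero]; exact_mod_cast hne
    have := key (t / (2 * (C₁ * C₀ + 1))) (by positivity)
    norm_cast at this
    have h5 : C₁ * C₀ * (t / (2 * (C₁ * C₀ + 1))) < t := by
      rw [mul_div_assoc', div_lt_iff₀ (by positivity)]
      have : 0 < t * (C₁ * C₀) + 2 * t := by positivity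
      calc C₁ * C₀ * t < C₁ * C₀ * t + (t * (C₁ * C₀) + 2 * t) := lt_add_of_pos_right _ this
        _ = _ := by ring
    exact absurd this (not_le.2 h5)
  rcases mul_eq_zero.1 h0 with h | h
  · exact absurd h (by exact_mod_cast hη.ne')
  · exact h

/-- Cover the radial part of a ν-null set by shadows inside an open set of small ν-measure. Vitali
and both halves of the shadow lemma transfer the smallness to μ, and radial sets exhaust the conical
set, which carries μ. -/
theorem IsProperMagnitude.absolutelyContinuous [IsFiniteMeasure μ] [IsFiniteMeasure ν]
    [ν.OuterRegular] (hN : IsProperMagnitude p o σ N) (hμ : IsShadowConformal p o w₁ μ)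
    (hν : IsShadowConformal p o w₂ ν) (hν0 : ν ≠ 0) (hfix : ∀ x : M, ∃ a : G, a • x ≠ x)
    {K : ℝ≥0} (hK : ∀ g, w₁ g ≤ K * w₂ g) (hcon : μ (conicalSet G p o)ᶜ = 0) : μ ≪ ν := by
  have := h.countable
  obtain ⟨ε₀, hε₀, hsh⟩ := hν.exists_le_measure_shadow h hν0 hfix
  intro A hA
  have key : ∀ ε > 0, ε ≤ ε₀ → μ (A ∩ radialSet G p o ε) = 0 := by
    intro ε hε hεε₀
    obtain ⟨C₀, hC₀⟩ := hsh ε hε hεε₀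
    obtain ⟨ε', hε', hV⟩ := hN.exists_disjoint_shadows h hε
    obtain ⟨C₁, hC₁⟩ := hμ.exists_measure_shadow_le h hε'
    have key : ∀ δ : ℝ≥0, 0 < δ → μ (A ∩ radialSet G p o ε) ≤ (C₁ * K * C₀ : ℝ≥0) * δ := by
      intro δ hδ
      obtain ⟨U, hAU, hU, hUδ⟩ := A.exists_isOpen_lt_add (μ := ν) (measure_ne_top _ _)
        (ENNReal.coe_ne_zero.2 hδ.ne')
      obtain ⟨u, -, hudisj, huU, hXu⟩ := hV univ U (A ∩ radialSet G p o ε) hU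
        (inter_subset_left.trans hAU) (fun x hx => hx.2.mono fun g hg => ⟨trivial, hg⟩)
      calc μ (A ∩ radialSet G p o ε) ≤ ∑' g : u, μ (shadow p o ε' (g : G)) :=
            (measure_mono hXu).trans (measure_biUnion_le _ (to_countable u) _)
        _ ≤ ∑' g : u, (C₁ * K * C₀ : ℝ≥0) * ν (shadow p o ε (g : G)) := by
            refine ENNReal.tsum_le_tsum fun g => ?_
            calc μ (shadow p o ε' (g : G)) ≤ C₁ * w₁ g := hC₁ g
              _ ≤ C₁ * (K * (C₀ * ν (shadow p o ε (g : G)))) := by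
                gcongr
                calc (w₁ g : ℝ≥0∞) ≤ K * w₂ g := by exact_mod_cast hK g
                  _ ≤ _ := by gcongr; exact hC₀ g
              _ = _ := by push_cast; ring
        _ = (C₁ * K * C₀ : ℝ≥0) * ∑' g : u, ν (shadow p o ε (g : G)) := ENNReal.tsum_mul_left
        _ ≤ (C₁ * K * C₀ : ℝ≥0) * ν U := by
            gcongr
            exact tsum_measure_le_of_pairwiseDisjoint h
              (fun g => (h.isOpen_shadow ε g).measurableSet) hudisj huU
        _ ≤ _ := by
            gcongr
            simpa [hA] using hUδ.le
    have hlim : Tendsto (fun n : ℕ => ((C₁ * K * C₀ : ℝ≥0) : ℝ≥0∞) *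
        ((1 / ((n : ℝ≥0) + 1) : ℝ≥0) : ℝ≥0∞)) atTop (𝓝 0) := by
      have h1 : Tendsto (fun n : ℕ => (C₁ * K * C₀) * (1 / ((n : ℝ≥0) + 1))) atTop (𝓝 0) := by
        simpa using (tendsto_one_div_add_atTop_nhds_zero_nat (𝕜 := ℝ≥0)).const_mul (C₁ * K * C₀)
      simpa only [ENNReal.coe_mul, ENNReal.coe_zero] using ENNReal.tendsto_coe.2 h1
    exact le_antisymm (ge_of_tendsto' hlim fun n => key _ (by positivity)) bot_le
  have h1 : μ (A ∩ conicalSet G p o) = 0 := by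
    rw [h.conicalSet_eq_iUnion, inter_iUnion]
    refine measure_iUnion_null fun n => ?_
    exact measure_mono_null (inter_subset_inter_right _ (radialSet_anti (min_le_left _ ε₀)))
      (key (min (1 / ((n : ℝ) + 1)) ε₀) (by positivity) (min_le_right _ _))
  refine measure_mono_null (t := (A ∩ conicalSet G p o) ∪ (conicalSet G p o)ᶜ) ?_
    (measure_union_null h1 hcon)
  intro x hx
  by_cases hxc : x ∈ conicalSet G p o
  · exact Or.inl ⟨hx, hxc⟩
  · exact Or.inr hxc

end
-- Zooming in: measures which are not mutually singular are comparable
/-- Two finite measures which are not mutually singular are comparable on some set of positive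
measure. -/
theorem exists_comparable_of_not_mutuallySingular {M : Type*} [MeasurableSpace M]
    {μ ν : Measure M} [IsFiniteMeasure μ] [IsFiniteMeasure ν] (hns : ¬ μ ⟂ₘ ν) {L : Set M}
    (hL : MeasurableSet L) (hL0 : μ Lᶜ = 0 ∨ ν Lᶜ = 0) :
    ∃ (E : Set M) (k : ℝ≥0), MeasurableSet E ∧ E ⊆ L ∧ ν E ≠ 0 ∧
      ∀ A ⊆ E, MeasurableSet A → μ A ≤ k * ν A ∧ ν A ≤ k * μ A := by
  obtain ⟨Z, hZ, hZ1, hZ2⟩ := Measure.mutuallySingular_singularPart μ ν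
  set f := μ.rnDeriv ν with hf
  have hfm : Measurable f := Measure.measurable_rnDeriv μ ν
  have hμ : μ = μ.singularPart ν + ν.withDensity f := Measure.haveLebesgueDecomposition_add μ ν
  -- On Z the singular part of μ vanishes, so there μ is ν with density f. Cutting off f above and
  -- below gives comparability, and if all E n were ν-null then f would vanish ν-almost everywhere.
  let E : ℕ → Set M := fun n => L ∩ Z ∩ {x | ((n : ℝ≥0∞) + 1)⁻¹ ≤ f x ∧ f x ≤ n + 1}
  have hE : ∀ n, MeasurableSet (E n) := fun n =>
    (hL.inter hZ).inter ((measurableSet_le measurable_const hfm).inter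
      (measurableSet_le hfm measurable_const))
  have hval : ∀ n, ∀ A ⊆ E n, MeasurableSet A → μ A = ∫⁻ x in A, f x ∂ν := by
    intro n A hA hAm
    rw [hμ, Measure.add_apply, withDensity_apply _ hAm,
      measure_mono_null (fun x hx => (hA hx).1.2) hZ1, zero_add]
  by_cases hex : ∃ n, ν (E n) ≠ 0
  · obtain ⟨n, hn⟩ := hex
    refine ⟨E n, n + 1, hE n, fun x hx => hx.1.1, hn, fun A hA hAm => ⟨?_, ?_⟩⟩
    · rw [hval n A hA hAm]
      calc ∫⁻ x in A, f x ∂ν ≤ ∫⁻ x in A, (n + 1 : ℝ≥0∞) ∂ν :=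
            setLIntegral_mono measurable_const fun x hx => (hA hx).2.2
        _ = _ := by simp
    · rw [hval n A hA hAm]
      have h1 : ((n : ℝ≥0∞) + 1)⁻¹ * ν A ≤ ∫⁻ x in A, f x ∂ν := by
        rw [← setLIntegral_const]
        exact setLIntegral_mono hfm fun x hx => (hA hx).2.1
      calc ν A = (n + 1) * (((n : ℝ≥0∞) + 1)⁻¹ * ν A) := by
            rw [← mul_assoc, ENNReal.mul_inv_cancel (by simp) (by finiteness), one_mul]
        _ ≤ (n + 1) * ∫⁻ x in A, f x ∂ν := by gcongr
        _ = _ := by push_cast; rfl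
  · push Not at hex
    exfalso
    apply hns
    rw [← Measure.rnDeriv_eq_zero]
    have h1 : ∀ᵐ x ∂ν, ∀ n, x ∉ E n := ae_all_iff.2 fun n => measure_eq_zero_iff_ae_notMem.1 (hex n)
    have h2 : ∀ᵐ x ∂ν, x ∈ Z := by
      rw [ae_iff]; exact hZ2
    have h3 : ∀ᵐ x ∂ν, x ∉ L → f x = 0 := by
      rcases hL0 with h0 | h0
      · have h4 : ∫⁻ x in Lᶜ, f x ∂ν = 0 :=
          le_antisymm ((Measure.setLIntegral_rnDeriv_le _).trans h0.le) bot_le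
        rw [lintegral_eq_zero_iff hfm, Filter.EventuallyEq, ae_restrict_iff' hL.compl] at h4
        exact h4
      · have h4 : ∀ᵐ x ∂ν, x ∈ L := by
          rw [ae_iff]; exact h0
        filter_upwards [h4] with x hx hx'
        exact absurd hx hx'
    filter_upwards [h1, h2, h3, Measure.rnDeriv_lt_top μ ν] with x hx1 hx2 hx3 hx4
    by_contra hne
    have hxL : x ∈ L := by
      by_contra hxL
      exact hne (hx3 hxL)
    obtain ⟨n, hn⟩ := ENNReal.exists_inv_nat_lt hne
    obtain ⟨m, hm⟩ := ENNReal.exists_nat_gt hx4.ne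
    refine hx1 (max n m) ⟨⟨hxL, hx2⟩, ?_, ?_⟩
    · refine (ENNReal.inv_le_inv.2 ?_).trans hn.le
      calc (n : ℝ≥0∞) ≤ (max n m : ℕ) := by exact_mod_cast le_max_left n m
        _ ≤ _ := le_self_add
    · refine hm.le.trans ?_
      calc (m : ℝ≥0∞) ≤ (max n m : ℕ) := by exact_mod_cast le_max_right n m
        _ ≤ _ := le_self_add

section
variable {G M B : Type*} [Group G] [MulAction G M] [MulAction G B]
  [TopologicalSpace M] [CompactSpace M] [MetricSpace B] [CompactSpace B]
  [ContinuousConstSMul G B] [MeasurableSpace M] [BorelSpace M]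

variable {p : M → B} {o : B} {σ : G → M → ℝ} {N : G → ℝ} {w w₁ w₂ : G → ℝ≥0} {μ ν : Measure M}

variable (h : IsConvBord (G := G) p o)
include h

/-- Zooming in along shadows at a density point of `E`, the pullbacks of `E` fill up `M`. -/
theorem IsProperMagnitude.exists_tendsto_measure_farSet_diff [IsFiniteMeasure ν] [ν.OuterRegular]
    (hN : IsProperMagnitude p o σ N) (hν : IsShadowConformal p o w ν)
    (hfix : ∀ x : M, ∃ a : G, a • x ≠ x) {E : Set M} (hE : MeasurableSet E)
    (hEL : E ⊆ conicalSet G p o) (hE0 : ν E ≠ 0) :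
    ∃ (𝒰 : Ultrafilter G) (j₀ : ℕ), (𝒰 : Filter G) ≤ cofinite ∧ ∀ j ≥ j₀,
      Tendsto (fun g : G => ν (farSet p o (1 / ((j : ℝ) + 1)) g \ ((fun x => g • x) ⁻¹' E)))
        𝒰 (𝓝 0) := by
  have hν0 : ν ≠ 0 := by rintro rfl; simp at hE0
  obtain ⟨ε₀, hε₀, hsh⟩ := hν.exists_le_measure_shadow h hν0 hfix
  obtain ⟨j₁, hj₁⟩ := exists_nat_one_div_lt hε₀
  have hmono : ∀ {i j : ℕ}, i ≤ j → 1 / ((j : ℝ) + 1) ≤ 1 / ((i : ℝ) + 1) := fun hij =>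
    one_div_le_one_div_of_le (by positivity) (by gcongr)
  -- Discarding countably many null sets at once leaves a point x that is a density point at every
  -- small scale 1/(j+1) and for every fraction 1/(m+1). One ultrafilter, of elements whose ε-shadow
  -- contains x, then serves all j.
  have hnull : ν (⋃ (j : ℕ) (_ : j₁ ≤ j) (m : ℕ), E ∩ {x | ∃ᶠ g : G in cofinite,
      ((1 / ((m : ℝ≥0) + 1) : ℝ≥0) : ℝ≥0∞) * ν (shadow p o (1 / ((j : ℝ) + 1)) g) ≤
        ν (shadow p o (1 / ((j : ℝ) + 1)) g \ E) ∧ x ∈ shadow p o (1 / ((j : ℝ) + 1)) g}) = 0 := by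
    refine measure_iUnion_null fun j => measure_iUnion_null fun hj => measure_iUnion_null fun m => ?_
    obtain ⟨C₀, hC₀⟩ := hsh (1 / ((j : ℝ) + 1)) (by positivity) ((hmono hj).trans hj₁.le)
    exact hN.measure_inter_frequently_eq_zero h hν (by positivity) hC₀ hE (by positivity)
  obtain ⟨x, hxE, hx⟩ : ∃ x ∈ E, x ∉ (⋃ (j : ℕ) (_ : j₁ ≤ j) (m : ℕ), E ∩ {x | ∃ᶠ g : G in cofinite,
      ((1 / ((m : ℝ≥0) + 1) : ℝ≥0) : ℝ≥0∞) * ν (shadow p o (1 / ((j : ℝ) + 1)) g) ≤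
        ν (shadow p o (1 / ((j : ℝ) + 1)) g \ E) ∧ x ∈ shadow p o (1 / ((j : ℝ) + 1)) g}) := by
    by_contra! hcon
    exact hE0 (measure_mono_null hcon hnull)
  simp only [mem_iUnion, not_exists] at hx
  obtain ⟨ε, hε, hxε⟩ := hEL hxE
  obtain ⟨j₂, hj₂⟩ := exists_nat_one_div_lt hε
  have hne := Filter.frequently_iff_neBot.1 hxε
  let 𝒰 : Ultrafilter G := @Ultrafilter.of _ _ hne
  have h𝒰 : (𝒰 : Filter G) ≤ cofinite := (Ultrafilter.of_le _).trans inf_le_left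
  have h𝒰x : ∀ᶠ g : G in (𝒰 : Filter G), x ∈ shadow p o ε g :=
    (Ultrafilter.of_le _).trans inf_le_right (mem_principal_self _)
  refine ⟨𝒰, max j₁ j₂, h𝒰, fun j hj => ?_⟩
  obtain ⟨C, hC⟩ := hν.scale (1 / ((j : ℝ) + 1)) (by positivity)
  -- One factor C rescales the shadow minus E back to the far set; the other, with the total mass,
  -- bounds the measure of the shadow itself.
  set D : ℝ≥0 := C * (C * (ν univ).toNNReal)
  have hbound : ∀ m : ℕ, ∀ᶠ g : G in (𝒰 : Filter G),
      ν (farSet p o (1 / ((j : ℝ) + 1)) g \ ((fun x => g • x) ⁻¹' E)) ≤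
        ((D * (1 / ((m : ℝ≥0) + 1)) : ℝ≥0) : ℝ≥0∞) := by
    intro m
    have h1 := hx j ((le_max_left _ _).trans hj) m
    have h2 : ∀ᶠ g : G in cofinite, ¬ (((1 / ((m : ℝ≥0) + 1) : ℝ≥0) : ℝ≥0∞) *
        ν (shadow p o (1 / ((j : ℝ) + 1)) g) ≤ ν (shadow p o (1 / ((j : ℝ) + 1)) g \ E) ∧
        x ∈ shadow p o (1 / ((j : ℝ) + 1)) g) := by
      by_contra hcon
      exact h1 ⟨hxE, hcon⟩
    filter_upwards [h𝒰 h2, h𝒰x] with g hg hgx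
    have hgx' : x ∈ shadow p o (1 / ((j : ℝ) + 1)) g :=
      shadow_anti ((hmono ((le_max_right _ _).trans hj)).trans hj₂.le) g hgx
    have h3 := le_of_not_ge fun hle => hg ⟨hle, hgx'⟩
    have hfm : MeasurableSet (farSet p o (1 / ((j : ℝ) + 1)) g) := (h.isOpen_farSet _ g).measurableSet
    have h4 := (hC g _ (hfm.diff (h.measurable_smul g hE)) sdiff_subset).2
    have h5 := (hC g _ hfm subset_rfl).1
    have h6 : (fun x : M => g⁻¹ • x) ⁻¹' (farSet p o (1 / ((j : ℝ) + 1)) g \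
        ((fun x => g • x) ⁻¹' E)) = shadow p o (1 / ((j : ℝ) + 1)) g \ E := by
      ext y
      simp [farSet, shadow]
    rw [h6] at h4
    have hw : (w g : ℝ≥0∞) ≠ 0 := by exact_mod_cast (hν.pos g).ne'
    refine (ENNReal.mul_le_mul_iff_right hw ENNReal.coe_ne_top).1 (h4.trans ?_)
    calc (C : ℝ≥0∞) * ν (shadow p o (1 / ((j : ℝ) + 1)) g \ E)
        ≤ C * (((1 / ((m : ℝ≥0) + 1) : ℝ≥0) : ℝ≥0∞) * (C * w g * ν univ)) := by
          gcongr
          refine h3.trans ?_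
          gcongr
          refine h5.trans ?_
          gcongr
          exact subset_univ _
      _ = _ := by
          simp only [D]
          rw [ENNReal.coe_mul, ENNReal.coe_mul, ENNReal.coe_mul,
            ENNReal.coe_toNNReal (measure_ne_top _ _)]
          ring
  have hlim : Tendsto (fun m : ℕ => ((D * (1 / ((m : ℝ≥0) + 1)) : ℝ≥0) : ℝ≥0∞)) atTop (𝓝 0) := by
    have h1 : Tendsto (fun n : ℕ => D * (1 / ((n : ℝ≥0) + 1))) atTop (𝓝 0) := by
      simpa using (tendsto_one_div_add_atTop_nhds_zero_nat (𝕜 := ℝ≥0)).const_mul D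
    simpa only [ENNReal.coe_zero] using ENNReal.tendsto_coe.2 h1
  rw [ENNReal.tendsto_nhds_zero]
  intro δ hδ
  obtain ⟨m, hm⟩ := (hlim.eventually (gt_mem_nhds hδ)).exists
  filter_upwards [hbound m] with g hg
  exact hg.trans hm.le

/-- If `ν` is dominated by `μ` outside a small ball around a non-fixed point, then everywhere. -/
theorem IsShadowConformal.le_smul_of_cover (hμ : IsShadowConformal p o w₁ μ)
    (hν : IsShadowConformal p o w₂ ν) {W : Set M} (hW : MeasurableSet W) {a : G}
    (hcov : ∀ y : M, y ∈ W ∨ a⁻¹ • y ∈ W) {D : ℝ≥0}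
    (hD : ∀ A ⊆ W, MeasurableSet A → ν A ≤ D * μ A) : ∃ C : ℝ≥0, ν ≤ C • μ := by
  obtain ⟨C₁, hC₁⟩ := hμ.exists_measure_preimage_le h a
  obtain ⟨C₂, hC₂⟩ := hν.exists_measure_le_preimage h a
  refine ⟨D + C₂ * D * C₁, Measure.le_iff.2 fun A hA => ?_⟩
  have h1 : ν (A \ W) ≤ C₂ * (D * (C₁ * μ (A \ W))) := by
    have hAm : MeasurableSet (A \ W) := hA.diff hW
    refine (hC₂ _ hAm).trans ?_
    gcongr
    refine (hD _ ?_ (h.measurable_smul a hAm)).trans (by gcongr; exact hC₁ _ hAm)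
    intro y hy
    have := (hcov (a • y)).resolve_left hy.2
    simpa using this
  calc ν A = ν (A ∩ W) + ν (A \ W) := (measure_inter_add_sdiff _ hW).symm
    _ ≤ D * μ (A ∩ W) + C₂ * (D * (C₁ * μ (A \ W))) :=
        add_le_add (hD _ inter_subset_right (hA.inter hW)) h1
    _ ≤ D * μ A + C₂ * (D * (C₁ * μ A)) := by
        gcongr
        · exact inter_subset_left
        · exact sdiff_subset
    _ = (D + C₂ * D * C₁ : ℝ≥0) * μ A := by push_cast; ring
    _ = _ := by simp [ENNReal.smul_def]

/-- If y and a⁻¹ • y were both arbitrarily close to b, continuity would give a • b = b. -/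
theorem IsConvBord.exists_cover {a : G} {b : M} (hab : a • b ≠ b) :
    ∃ r > 0, ∀ y : M, r < dist (p y) (p b) ∨ r < dist (p (a⁻¹ • y)) (p b) := by
  by_contra! hcon
  choose y hy1 hy2 using fun n : ℕ => hcon (1 / ((n : ℝ) + 1)) (by positivity)
  have hlim : ∀ z : ℕ → M, (∀ n : ℕ, dist (p (z n)) (p b) ≤ 1 / ((n : ℝ) + 1)) →
      Tendsto z atTop (𝓝 b) := by
    intro z hz
    rw [h.isClosedEmbedding.isEmbedding.tendsto_nhds_iff, tendsto_iff_dist_tendsto_zero]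
    exact squeeze_zero (fun _ => dist_nonneg) hz tendsto_one_div_add_atTop_nhds_zero_nat
  have := h.continuousConstSMul
  have := h.t2Space
  refine hab (tendsto_nhds_unique ?_ (hlim y hy1))
  refine (((continuous_const_smul a).tendsto b).comp (hlim _ hy2)).congr fun n => ?_
  simp

/-- A shadow conformal measure charging the conical limit set which is not singular to another
one is dominated by it. -/
theorem IsProperMagnitude.exists_le_smul [IsFiniteMeasure μ] [IsFiniteMeasure ν] [ν.OuterRegular]
    (hN : IsProperMagnitude p o σ N) (hμ : IsShadowConformal p o w₁ μ)
    (hν : IsShadowConformal p o w₂ ν) (hfix : ∀ x : M, ∃ a : G, a • x ≠ x) (hns : ¬ μ ⟂ₘ ν)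
    (hcon : μ (conicalSet G p o)ᶜ = 0 ∨ ν (conicalSet G p o)ᶜ = 0) : ∃ C : ℝ≥0, ν ≤ C • μ := by
  obtain ⟨E, k, hE, hEL, hE0, hEk⟩ :=
    exists_comparable_of_not_mutuallySingular hns h.measurableSet_conicalSet hcon
  obtain ⟨𝒰, j₀, h𝒰, hlim⟩ :=
    hN.exists_tendsto_measure_farSet_diff h hν hfix hE hEL hE0
  obtain ⟨b, hb⟩ := h.exists_tendsto_base (tendsto_inv_cofinite (tendsto_id.mono_left h𝒰))
  simp only [id] at hb
  obtain ⟨a, hab⟩ := hfix b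
  have := h.t2Space
  obtain ⟨r₁, hr₁, hcov⟩ := h.exists_cover hab
  -- The reference set needs mass away from b. If ν charges E only at b, then b is an atom in E, and
  -- the translate a • E charges a • b ≠ b.
  obtain ⟨E', k', hE', hE'0, hE'k⟩ : ∃ (E' : Set M) (k' : ℝ≥0), MeasurableSet E' ∧
      ν (E' \ {b}) ≠ 0 ∧ ∀ A ⊆ E', MeasurableSet A → ν A ≤ k' * μ A := by
    by_cases hEb : ν (E \ {b}) = 0
    · obtain ⟨C₁, hC₁⟩ := hμ.exists_measure_preimage_le h a
      obtain ⟨C₂, hC₂⟩ := hν.exists_measure_le_preimage h a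
      obtain ⟨C₃, hC₃⟩ := hν.exists_measure_preimage_le h a
      have hm : MeasurableSet ((fun x : M => a⁻¹ • x) ⁻¹' E) := h.measurable_smul a⁻¹ hE
      have hb0 : ν (E ∩ {b}) ≠ 0 := by
        intro h0
        apply hE0
        rw [← inter_union_sdiff E {b}]
        exact measure_union_null h0 hEb
      have hbE : b ∈ E := by
        by_contra hbE
        rw [inter_singleton_eq_empty.2 hbE] at hb0
        simp at hb0
      refine ⟨(fun x : M => a⁻¹ • x) ⁻¹' E, C₂ * (k * C₁), hm, ?_, fun A hA hAm => ?_⟩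
      · intro h0
        have h1 : ν {a • b} = 0 := measure_mono_null (by simpa [hbE] using hab) h0
        have h2 := hC₃ _ (measurableSet_singleton (a • b))
        rw [h1, mul_zero] at h2
        exact hb0 (measure_mono_null (fun x hx => by simp [mem_singleton_iff.1 hx.2])
          (le_antisymm h2 bot_le))
      · calc ν A ≤ C₂ * (k * (C₁ * μ A)) := by
              refine (hC₂ A hAm).trans ?_
              gcongr
              refine (hEk _ (fun y hy => ?_) (h.measurable_smul a hAm)).2.trans
                (by gcongr; exact hC₁ A hAm)
              have := hA hy
              simpa using this
          _ = _ := by push_cast; ring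
    · exact ⟨E, k, hE, hEb, fun A hA hAm => (hEk A hA hAm).2⟩
  obtain ⟨j, hj, hjr, hjE⟩ : ∃ j : ℕ, j₀ ≤ j ∧ 2 * (1 / ((j : ℝ) + 1)) < r₁ ∧
      ν (E' ∩ {y | 2 * (1 / ((j : ℝ) + 1)) < dist (p y) (p b)}) ≠ 0 := by
    have h1 : ν (⋃ j : ℕ, E' ∩ {y | 2 * (1 / ((j : ℝ) + 1)) < dist (p y) (p b)}) ≠ 0 := by
      intro h0
      refine hE'0 (measure_mono_null (fun y hy => ?_) h0)
      have hd : 0 < dist (p y) (p b) := dist_pos.2 (h.injective.ne hy.2)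
      obtain ⟨n, hn⟩ := exists_nat_one_div_lt (half_pos hd)
      exact mem_iUnion.2 ⟨n, hy.1, by show 2 * (1 / ((n : ℝ) + 1)) < dist (p y) (p b); linarith⟩
    obtain ⟨j₁, hj₁⟩ : ∃ j : ℕ, ν (E' ∩ {y | 2 * (1 / ((j : ℝ) + 1)) < dist (p y) (p b)}) ≠ 0 := by
      by_contra! h2
      exact h1 (measure_iUnion_null h2)
    obtain ⟨j₂, hj₂⟩ := exists_nat_one_div_lt (half_pos hr₁)
    have hmono : ∀ {i j : ℕ}, i ≤ j → 1 / ((j : ℝ) + 1) ≤ 1 / ((i : ℝ) + 1) := fun hij =>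
      one_div_le_one_div_of_le (by positivity) (by gcongr)
    refine ⟨max j₀ (max j₁ j₂), le_max_left _ _, ?_, fun h0 => hj₁ (measure_mono_null ?_ h0)⟩
    · have := hmono ((le_max_right j₁ j₂).trans (le_max_right j₀ _))
      linarith
    · refine inter_subset_inter_right _ fun y hy => ?_
      have := hmono ((le_max_left j₁ j₂).trans (le_max_right j₀ _))
      have hy : 2 * (1 / ((j₁ : ℝ) + 1)) < dist (p y) (p b) := hy
      show 2 * (1 / (((max j₀ (max j₁ j₂) : ℕ) : ℝ) + 1)) < dist (p y) (p b)
      linarith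
  have hε : 0 < 1 / ((j : ℝ) + 1) := by positivity
  set ε := 1 / ((j : ℝ) + 1)
  set W : Set M := {y | 2 * ε < dist (p y) (p b)} with hWdef
  have hW : MeasurableSet W :=
    (isOpen_lt continuous_const (h.continuous.dist continuous_const)).measurableSet
  have hWfar : ∀ᶠ g : G in (𝒰 : Filter G), W ⊆ farSet p o ε g := by
    filter_upwards [Metric.tendsto_nhds.1 hb ε hε] with g hg y hy
    have hy : 2 * ε < dist (p y) (p b) := hy
    have := dist_triangle (p y) (g⁻¹ • o) (p b)
    show ε < dist (p y) (g⁻¹ • o)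
    linarith
  obtain ⟨C₁, hC₁⟩ := hμ.scale ε hε
  obtain ⟨C₂, hC₂⟩ := hν.scale ε hε
  -- Push a subset of W ∩ g⁻¹E into E by g, compare the two measures there, and pull back; each
  -- passage costs the weight of g.
  have hcomp : ∀ g : G, W ⊆ farSet p o ε g → ∀ A ⊆ W ∩ ((fun x => g • x) ⁻¹' E), MeasurableSet A →
      w₂ g * ν A ≤ (C₁ * k * C₂ : ℝ≥0) * (w₁ g * μ A) ∧
      w₁ g * μ A ≤ (C₁ * k * C₂ : ℝ≥0) * (w₂ g * ν A) := by
    intro g hg A hA hAm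
    have hAE : (fun x : M => g⁻¹ • x) ⁻¹' A ⊆ E := fun y hy => by simpa using (hA hy).2
    have hAm' : MeasurableSet ((fun x : M => g⁻¹ • x) ⁻¹' A) := h.measurable_smul g⁻¹ hAm
    have h1 := hC₁ g A hAm ((hA.trans inter_subset_left).trans hg)
    have h2 := hC₂ g A hAm ((hA.trans inter_subset_left).trans hg)
    have h3 := hEk _ hAE hAm'
    constructor
    · calc w₂ g * ν A ≤ C₂ * (k * (C₁ * w₁ g * μ A)) := by
            refine h2.2.trans ?_
            gcongr
            refine h3.2.trans ?_
            gcongr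
            exact h1.1
        _ = _ := by push_cast; ring
    · calc w₁ g * μ A ≤ C₁ * (k * (C₂ * w₂ g * ν A)) := by
            refine h1.2.trans ?_
            gcongr
            refine h3.1.trans ?_
            gcongr
            exact h2.1
        _ = _ := by push_cast; ring
  set D := C₁ * k * C₂
  have hsmall : ∀ g : G, W ⊆ farSet p o ε g → ∀ A ⊆ W, ν A ≤ ν (A ∩ ((fun x => g • x) ⁻¹' E)) +
      ν (farSet p o ε g \ ((fun x => g • x) ⁻¹' E)) := by
    intro g hg A hA
    refine (measure_mono fun y hy => ?_).trans (measure_union_le _ _)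
    by_cases hyE : g • y ∈ E
    · exact Or.inl ⟨hy, hyE⟩
    · exact Or.inr ⟨hg (hA hy), hyE⟩
  -- The part of the fixed set E' ∩ W inside g⁻¹E eventually has positive ν-measure. On it ν ≤ k' μ
  -- holds directly, while w₁ μ ≤ D w₂ ν by zooming, which bounds the ratio of the weights.
  have hwle : ∀ᶠ g : G in (𝒰 : Filter G), w₁ g ≤ k' * D * w₂ g := by
    filter_upwards [hWfar, (hlim j hj).eventually (gt_mem_nhds (pos_iff_ne_zero.2 hjE))]
      with g hg1 hg2
    set A := (E' ∩ W) ∩ ((fun x => g • x) ⁻¹' E)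
    have hAm : MeasurableSet A := (hE'.inter hW).inter (h.measurable_smul g hE)
    have hA0 : ν A ≠ 0 := by
      intro h0
      have := hsmall g hg1 (E' ∩ W) inter_subset_right
      rw [show (E' ∩ W) ∩ ((fun x => g • x) ⁻¹' E) = A from rfl, h0, zero_add] at this
      exact absurd hg2 (not_lt.2 this)
    have h1 := (hcomp g hg1 A (inter_subset_inter_left _ inter_subset_right) hAm).2
    have h2 := hE'k A (inter_subset_left.trans inter_subset_left) hAm
    have h3 : (w₁ g : ℝ≥0∞) * ν A ≤ (k' * D * w₂ g : ℝ≥0) * ν A := by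
      calc (w₁ g : ℝ≥0∞) * ν A ≤ w₁ g * (k' * μ A) := by gcongr
        _ = k' * (w₁ g * μ A) := by ring
        _ ≤ k' * (D * (w₂ g * ν A)) := by gcongr
        _ = _ := by push_cast; ring
    exact_mod_cast (ENNReal.mul_le_mul_iff_left hA0 (measure_ne_top _ _)).1 h3
  -- On W the bound for ν is D times the weight ratio k' * D, plus an error that vanishes along the
  -- ultrafilter.
  refine hμ.le_smul_of_cover h hν hW (a := a) (D := D * (k' * D)) (fun y => ?_) fun A hA hAm => ?_
  · rcases hcov y with hy | hy
    · exact Or.inl (hjr.trans hy)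
    · exact Or.inr (hjr.trans hy)
  · have hlim2 : Tendsto (fun g : G => ((D * (k' * D) : ℝ≥0) : ℝ≥0∞) * μ A +
        ν (farSet p o ε g \ ((fun x => g • x) ⁻¹' E))) 𝒰
        (𝓝 (((D * (k' * D) : ℝ≥0) : ℝ≥0∞) * μ A + 0)) := tendsto_const_nhds.add (hlim j hj)
    rw [add_zero] at hlim2
    refine ge_of_tendsto hlim2 ?_
    filter_upwards [hWfar, hwle] with g hg1 hg2
    refine (hsmall g hg1 A hA).trans ?_
    gcongr
    have h1 := (hcomp g hg1 _ (inter_subset_inter_left _ hA)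
      (hAm.inter (h.measurable_smul g hE))).1
    have hw : (w₂ g : ℝ≥0∞) ≠ 0 := by exact_mod_cast (hν.pos g).ne'
    refine (ENNReal.mul_le_mul_iff_right hw ENNReal.coe_ne_top).1 (h1.trans ?_)
    calc (D : ℝ≥0∞) * (w₁ g * μ (A ∩ (fun x => g • x) ⁻¹' E))
        ≤ D * ((k' * D * w₂ g : ℝ≥0) * μ A) := by
          gcongr
          · exact inter_subset_left
      _ = _ := by push_cast; ring

end
-- Second moment method: Paley–Zygmund and Kochen–Stone
theorem integrable_sum_indicator {G M : Type*} [MeasurableSpace M] {μ : Measure M}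
    [IsFiniteMeasure μ] {S : G → Set M} (hS : ∀ g, MeasurableSet (S g)) (T : Finset G) :
    Integrable (fun x => ∑ g ∈ T, (S g).indicator (fun _ => (1 : ℝ)) x) μ :=
  integrable_finsetSum _ fun g _ => (integrable_const 1).indicator (hS g)

theorem integral_sum_indicator {G M : Type*} [MeasurableSpace M] {μ : Measure M}
    [IsFiniteMeasure μ] {S : G → Set M} (hS : ∀ g, MeasurableSet (S g)) (T : Finset G) :
    ∫ x, ∑ g ∈ T, (S g).indicator (fun _ => (1 : ℝ)) x ∂μ = ∑ g ∈ T, μ.real (S g) := by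
  rw [integral_finsetSum _ fun g _ => (integrable_const 1).indicator (hS g)]
  refine Finset.sum_congr rfl fun g _ => ?_
  rw [integral_indicator_const _ (hS g)]
  simp

/-- The Paley–Zygmund inequality for a counting function. -/
theorem le_measureReal_of_sum_inter_le {G M : Type*} [MeasurableSpace M] {μ : Measure M}
    [IsFiniteMeasure μ] {S : G → Set M} (hS : ∀ g, MeasurableSet (S g)) (T : Finset G) {C a : ℝ}
    (hC : 0 < C) (ha : a = ∑ g ∈ T, μ.real (S g)) (ha0 : 0 < a)
    (hle : ∑ g ∈ T, ∑ g' ∈ T, μ.real (S g ∩ S g') ≤ C * a ^ 2) :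
    1 / (4 * C) ≤ μ.real {x | a / (2 * (μ.real univ + 1)) <
      ∑ g ∈ T, (S g).indicator (fun _ => (1 : ℝ)) x} := by
  set m := μ.real univ with hm
  have hm0 : 0 ≤ m := measureReal_nonneg
  set f : M → ℝ := fun x => ∑ g ∈ T, (S g).indicator (fun _ => (1 : ℝ)) x with hf
  have hfint : Integrable f μ := integrable_sum_indicator hS T
  have hfm : Measurable f := Finset.measurable_sum _ fun g _ => measurable_const.indicator (hS g)
  have hsq : ∀ x, f x ^ 2 = ∑ q ∈ T ×ˢ T, (S q.1 ∩ S q.2).indicator (fun _ => (1 : ℝ)) x := by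
    intro x
    rw [Finset.sum_product, sq, hf, Finset.sum_mul_sum]
    refine Finset.sum_congr rfl fun g _ => Finset.sum_congr rfl fun g' _ => ?_
    by_cases h1 : x ∈ S g <;> by_cases h2 : x ∈ S g' <;> simp [h1, h2]
  have hS2 : ∀ q : G × G, MeasurableSet (S q.1 ∩ S q.2) := fun q => (hS _).inter (hS _)
  have hf2int : Integrable (fun x => f x ^ 2) μ := by
    simp_rw [hsq]; exact integrable_sum_indicator hS2 _
  have hf2 : ∫ x, f x ^ 2 ∂μ ≤ C * a ^ 2 := by
    simp_rw [hsq]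
    rw [integral_sum_indicator hS2, Finset.sum_product]
    exact hle
  have hf1 : ∫ x, f x ∂μ = a := by rw [ha]; exact integral_sum_indicator hS T
  set E := {x | a / (2 * (m + 1)) < f x} with hE
  have hEm : MeasurableSet E := measurableSet_lt measurable_const hfm
  -- This t makes the quadratic term at most a/4. The threshold in E contributes at most a/2, so the
  -- indicator term must supply the remaining a/4; m + 1 in place of m avoids division by zero.
  set t := 1 / (2 * C * a) with ht
  have ht0 : 0 < t := by positivity
  have hpt : ∀ x, f x ≤ a / (2 * (m + 1)) + t / 2 * f x ^ 2 +
      1 / (2 * t) * E.indicator (fun _ => (1 : ℝ)) x := by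
    intro x
    have hs : 0 < a / (2 * (m + 1)) := by positivity
    by_cases hx : x ∈ E
    · have h1 : 0 ≤ (t * f x - 1) ^ 2 / (2 * t) := by positivity
      have h2 : (t * f x - 1) ^ 2 / (2 * t) = t / 2 * f x ^ 2 - f x + 1 / (2 * t) := by
        field_simp
        ring
      simp only [hx, indicator_of_mem, mul_one]
      linarith
    · have h1 : f x ≤ a / (2 * (m + 1)) := not_lt.1 hx
      simp only [hx, not_false_eq_true, indicator_of_notMem, mul_zero, add_zero]
      have : 0 ≤ t / 2 * f x ^ 2 := by positivity
      linarith
  have hEint : Integrable (E.indicator (fun _ => (1 : ℝ))) μ := (integrable_const 1).indicator hEm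
  have hint : ∫ x, f x ∂μ ≤ a / (2 * (m + 1)) * m + t / 2 * ∫ x, f x ^ 2 ∂μ +
      1 / (2 * t) * μ.real E := by
    refine (integral_mono hfint (((integrable_const _).add (hf2int.const_mul _)).add
      (hEint.const_mul _)) hpt).trans_eq ?_
    rw [integral_add' ((integrable_const _).add (hf2int.const_mul _)) (hEint.const_mul _),
      integral_add' (integrable_const _) (hf2int.const_mul _), integral_const_mul,
      integral_const_mul, integral_indicator_const _ hEm]
    simp [hm, mul_comm]
  rw [hf1] at hint
  have e1 : a / (2 * (m + 1)) * m ≤ a / 2 := by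
    rw [div_mul_eq_mul_div, div_le_div_iff₀ (by positivity) (by positivity)]
    nlinarith
  have e2 : t / 2 * ∫ x, f x ^ 2 ∂μ ≤ a / 4 := by
    calc t / 2 * ∫ x, f x ^ 2 ∂μ ≤ t / 2 * (C * a ^ 2) := by gcongr
      _ = a / 4 := by rw [ht]; field_simp; norm_num
  have e3 : 1 / (2 * t) = C * a := by rw [ht]; field_simp
  rw [e3] at hint
  have e4 : a * (1 / 4) ≤ a * (C * μ.real E) := by nlinarith
  have e5 := le_of_mul_le_mul_left e4 ha0
  rw [div_le_iff₀ (by positivity)]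
  linarith

/-- The Kochen–Stone lemma. -/
theorem measure_frequently_mem_ne_zero {G M : Type*} [MeasurableSpace M] {μ : Measure M}
    [IsFiniteMeasure μ] {S : G → Set M} (hS : ∀ g, MeasurableSet (S g)) (T : ℕ → Finset G) {C : ℝ}
    (hC : 0 < C) (hlim : Tendsto (fun n => ∑ g ∈ T n, μ.real (S g)) atTop atTop)
    (hle : ∀ᶠ n in atTop, ∑ g ∈ T n, ∑ g' ∈ T n, μ.real (S g ∩ S g') ≤
      C * (∑ g ∈ T n, μ.real (S g)) ^ 2) :
    μ {x | ∃ᶠ g in cofinite, x ∈ S g} ≠ 0 := by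
  set m := μ.real univ with hm
  have hm0 : 0 ≤ m := measureReal_nonneg
  let E : ℕ → Set M := fun n => {x | (∑ g ∈ T n, μ.real (S g)) / (2 * (m + 1)) <
      ∑ g ∈ T n, (S g).indicator (fun _ => (1 : ℝ)) x}
  have hEm : ∀ n, MeasurableSet (E n) := fun n => measurableSet_lt measurable_const
    (Finset.measurable_sum _ fun g _ => measurable_const.indicator (hS g))
  have hEle : ∀ᶠ n in atTop, ENNReal.ofReal (1 / (4 * C)) ≤ μ (E n) := by
    filter_upwards [hle, hlim.eventually (eventually_gt_atTop 0)] with n h1 h2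
    rw [ENNReal.ofReal_le_iff_le_toReal (measure_ne_top _ _)]
    exact le_measureReal_of_sum_inter_le hS (T n) hC rfl h2 h1
  let E' : ℕ → Set M := fun n => ⋃ k ≥ n, E k
  have hE'anti : Antitone E' := by
    intro i j hij x hx
    simp only [E', mem_iUnion] at hx ⊢
    obtain ⟨k, hk, hx⟩ := hx
    exact ⟨k, hij.trans hk, hx⟩
  have hE'm : ∀ n, NullMeasurableSet (E' n) μ := fun n =>
    (MeasurableSet.iUnion fun k => .iUnion fun _ => hEm k).nullMeasurableSet
  have h1 := tendsto_measure_iInter_atTop hE'm hE'anti ⟨0, measure_ne_top μ _⟩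
  have h2 : ENNReal.ofReal (1 / (4 * C)) ≤ μ (⋂ n, E' n) := by
    refine ge_of_tendsto' h1 fun n => ?_
    obtain ⟨k, hk, hkn⟩ := (hEle.and (eventually_ge_atTop n)).exists
    exact hk.trans (measure_mono (subset_iUnion₂_of_subset k hkn subset_rfl))
  -- A point in only finitely many S g has bounded counting functions, whereas the thresholds
  -- defining E n tend to infinity.
  have h3 : (⋂ n, E' n) ⊆ {x | ∃ᶠ g in cofinite, x ∈ S g} := by
    intro x hx
    by_contra hcon
    have hfin : {g | x ∈ S g}.Finite := by
      have := not_frequently.1 hcon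
      simpa using Filter.eventually_cofinite.1 this
    obtain ⟨n₀, hn₀⟩ := (hlim.eventually (eventually_gt_atTop
      (hfin.toFinset.card * (2 * (m + 1))))).exists_forall_of_atTop
    have hxn := mem_iInter.1 hx n₀
    simp only [E', mem_iUnion] at hxn
    obtain ⟨k, hk, hxk⟩ := hxn
    have hxk : (∑ g ∈ T k, μ.real (S g)) / (2 * (m + 1)) <
      ∑ g ∈ T k, (S g).indicator (fun _ => (1 : ℝ)) x := hxk
    have h4 := hn₀ k hk
    rw [← lt_div_iff₀ (by positivity)] at h4
    classical
    have h5 : ∑ g ∈ T k, (S g).indicator (fun _ => (1 : ℝ)) x ≤ hfin.toFinset.card := by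
      simp only [indicator_apply]
      rw [Finset.sum_boole]
      gcongr
      intro g hg
      simpa using (Finset.mem_filter.1 hg).2
    linarith
  intro h0
  have h4 := measure_mono_null h3 h0
  rw [h4] at h2
  have : 0 < ENNReal.ofReal (1 / (4 * C)) := ENNReal.ofReal_pos.2 (by positivity)
  exact absurd h2 (not_le.2 this)

/-! ### A divergent Poincaré series gives the conical set full measure -/

section
variable {G M B : Type*} [Group G] [MulAction G M] [MulAction G B]
  [TopologicalSpace M] [CompactSpace M] [MetricSpace B] [CompactSpace B]
  [ContinuousConstSMul G B] [MeasurableSpace M] [BorelSpace M]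

variable {p : M → B} {o : B} {σ : G → M → ℝ} {N : G → ℝ} {w : G → ℝ≥0} {μ ν : Measure M} {δ : ℝ}

/-- The weight `exp (-δ N)`. -/
noncomputable def expWeight (δ : ℝ) (N : G → ℝ) (g : G) : ℝ≥0 := (Real.exp (-δ * N g)).toNNReal

omit [Group G] in
theorem coe_expWeight (δ : ℝ) (N : G → ℝ) (g : G) :
    (expWeight δ N g : ℝ) = Real.exp (-δ * N g) :=
  Real.coe_toNNReal _ (Real.exp_pos _).le

omit [Group G] in
theorem tendsto_sum_of_not_summable {W : G → ℝ} (hW : ∀ g, 0 ≤ W g) (hns : ¬ Summable W)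
    {N : G → ℝ} {T : ℕ → Finset G} (hT : ∀ n g, g ∈ T n ↔ N g ≤ n) :
    Tendsto (fun n => ∑ g ∈ T n, W g) atTop atTop := by
  refine tendsto_atTop_atTop_of_monotone ?_ fun b => ?_
  · intro i j hij
    refine Finset.sum_le_sum_of_subset_of_nonneg (fun g hg => ?_) fun g _ _ => hW g
    rw [hT] at hg ⊢
    exact hg.trans (by exact_mod_cast hij)
  · by_contra! hcon
    refine hns (summable_of_sum_le hW (c := b) fun s => ?_)
    obtain ⟨c, hc⟩ := (s.finite_toSet.image N).bddAbove
    obtain ⟨n, hn⟩ := exists_nat_ge c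
    refine (Finset.sum_le_sum_of_subset_of_nonneg (fun g hg => ?_) fun g _ _ => hW g).trans
      (hcon n).le
    rw [hT]
    exact (hc ⟨g, hg, rfl⟩).trans hn

variable (h : IsConvBord (G := G) p o)
include h

/-- Invariance of the conical set lets a hypothetical non-conical part of μ be treated as a measure
of the same kind. -/
theorem IsShadowConformal.restrict_compl_conicalSet (hμ : IsShadowConformal p o w μ) :
    IsShadowConformal p o w (μ.restrict (conicalSet G p o)ᶜ) := by
  refine ⟨hμ.pos, fun ε hε => ?_⟩
  obtain ⟨C, hC⟩ := hμ.scale ε hε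
  refine ⟨C, fun g A hA hAf => ?_⟩
  have hL : MeasurableSet (conicalSet G p o)ᶜ := h.measurableSet_conicalSet.compl
  have h1 : (fun x : M => g⁻¹ • x) ⁻¹' A ∩ (conicalSet G p o)ᶜ =
      (fun x : M => g⁻¹ • x) ⁻¹' (A ∩ (conicalSet G p o)ᶜ) := by
    ext x
    have : g⁻¹ • x ∈ conicalSet G p o ↔ x ∈ conicalSet G p o :=
      ⟨fun hx => by simpa using h.smul_mem_conicalSet g hx, fun hx => h.smul_mem_conicalSet _ hx⟩
    simp [this]
  rw [Measure.restrict_apply hA, Measure.restrict_apply (h.measurable_smul _ hA), h1]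
  exact hC g _ (hA.inter hL) (inter_subset_left.trans hAf)

/-- Shadows of elements with comparable magnitude overlap boundedly often. -/
theorem IsProperMagnitude.exists_sum_annulus_le [IsFiniteMeasure μ]
    (hN : IsProperMagnitude p o σ N) {ε : ℝ} (hε : 0 < ε) (c : ℝ) : ∃ K : ℝ, ∀ (R : ℝ)
      (A : Finset G), (∀ g ∈ A, R ≤ N g ∧ N g ≤ R + c) →
      ∑ g ∈ A, μ.real (shadow p o ε g) ≤ K := by
  classical
  obtain ⟨c₁, hadd⟩ := hN.exists_additive h hε 0
  set F := (hN.finite_le (c + c₁)).toFinset with hF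
  refine ⟨F.card * μ.real univ, fun R A hA => ?_⟩
  have hS : ∀ g : G, MeasurableSet (shadow p o ε g) := fun g => (h.isOpen_shadow ε g).measurableSet
  rw [← integral_sum_indicator hS A]
  have hpt : ∀ x, ∑ g ∈ A, (shadow p o ε g).indicator (fun _ => (1 : ℝ)) x ≤ F.card := by
    intro x
    simp only [indicator_apply]
    rw [Finset.sum_boole]
    norm_cast
    set Ax := A.filter fun g => x ∈ shadow p o ε g with hAx
    rcases Ax.eq_empty_or_nonempty with h0 | hne
    · simp [h0]
    -- Measured from the element a of least magnitude whose shadow contains x, every other such b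
    -- has N(a⁻¹b) bounded by additivity; properness leaves finitely many choices of a⁻¹b.
    · obtain ⟨a, ha, hmin⟩ := Ax.exists_min_image N hne
      refine Finset.card_le_card_of_injOn (fun b => a⁻¹ * b) (fun b hb => ?_)
        (fun b _ b' _ hbb => by simpa using hbb)
      have ha' := Finset.mem_filter.1 ha
      have hb' := Finset.mem_filter.1 hb
      have h1 := abs_le.1 (hadd a b ⟨x, ha'.2, hb'.2⟩ (by simpa using hmin b hb))
      have h2 := hA a ha'.1
      have h3 := hA b hb'.1
      simp only [hF, Finite.coe_toFinset]
      show N (a⁻¹ * b) ≤ c + c₁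
      linarith [h1.1, h2.1, h3.2]
  calc _ ≤ ∫ x, (F.card : ℝ) ∂μ := integral_mono (integrable_sum_indicator hS A)
        (integrable_const _) hpt
    _ = _ := by simp [mul_comm]

/-- Kochen–Stone applied to shadows over the balls N ≤ n. For meeting shadows with N a ≤ N b,
additivity bounds the mass of the intersection by a constant times W a * W (a⁻¹ * b), so the pair
sum is at most a constant times the square of the truncated Poincaré sum P. -/
theorem IsProperMagnitude.measure_radialSet_ne_zero [IsFiniteMeasure μ]
    (hN : IsProperMagnitude p o σ N) (hμ : IsShadowConformal p o (expWeight δ N) μ)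
    (hns : ¬ Summable fun g => Real.exp (-δ * N g)) {ε : ℝ} (hε : 0 < ε) {C₀ : ℝ≥0}
    (hC₀ : ∀ g : G, expWeight δ N g ≤ C₀ * μ (shadow p o ε g)) :
    μ (radialSet G p o ε) ≠ 0 := by
  classical
  set W : G → ℝ := fun g => Real.exp (-δ * N g) with hW
  have hW0 : ∀ g, 0 < W g := fun g => Real.exp_pos _
  obtain ⟨C₁, hC₁⟩ := hμ.exists_measure_shadow_le h hε
  have hlow : ∀ g, W g ≤ C₀ * μ.real (shadow p o ε g) := by
    intro g
    have := ENNReal.toReal_mono (by finiteness) (hC₀ g)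
    simpa [coe_expWeight, hW, Measure.real] using this
  have hupp : ∀ g, μ.real (shadow p o ε g) ≤ C₁ * W g := by
    intro g
    have := ENNReal.toReal_mono (by finiteness) (hC₁ g)
    simpa [coe_expWeight, hW, Measure.real] using this
  obtain ⟨c₁, hadd⟩ := hN.exists_additive h hε 0
  obtain ⟨cl, hcl⟩ := hN.exists_lowerBound
  -- For N a ≤ N b ≤ R and meeting shadows, N(a⁻¹b) ≤ R - cl + c₁ = R + c. Passing from P(R) to P(R
  -- + c) costs only a bounded amount, by the annulus estimate.
  set c := c₁ - cl with hc
  obtain ⟨K, hK⟩ := hN.exists_sum_annulus_le h (μ := μ) hε (max c 0)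
  let T : ℝ → Finset G := fun R => (hN.finite_le R).toFinset
  have hT : ∀ R g, g ∈ T R ↔ N g ≤ R := fun R g => by simp [T]
  let P : ℝ → ℝ := fun R => ∑ g ∈ T R, W g
  have hPc : ∀ R, P (R + c) ≤ P R + C₀ * K := by
    intro R
    have h1 : T (R + c) ⊆ T R ∪ (T (R + max c 0) \ T R) := by
      intro g hg
      rw [hT] at hg
      simp only [Finset.mem_union, Finset.mem_sdiff, hT]
      have := le_max_left c 0
      by_cases hgR : N g ≤ R
      · exact Or.inl hgR
      · exact Or.inr ⟨by linarith, hgR⟩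
    calc P (R + c) ≤ ∑ g ∈ T R ∪ (T (R + max c 0) \ T R), W g :=
          Finset.sum_le_sum_of_subset_of_nonneg h1 fun g _ _ => (hW0 g).le
      _ = P R + ∑ g ∈ T (R + max c 0) \ T R, W g :=
          Finset.sum_union Finset.disjoint_sdiff
      _ ≤ P R + C₀ * K := by
          gcongr
          calc ∑ g ∈ T (R + max c 0) \ T R, W g
              ≤ ∑ g ∈ T (R + max c 0) \ T R, C₀ * μ.real (shadow p o ε g) :=
                Finset.sum_le_sum fun g _ => hlow g
            _ = C₀ * ∑ g ∈ T (R + max c 0) \ T R, μ.real (shadow p o ε g) := by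
                rw [Finset.mul_sum]
            _ ≤ _ := by
                gcongr
                refine hK R _ fun g hg => ?_
                simp only [Finset.mem_sdiff, hT, not_le] at hg
                exact ⟨hg.2.le, hg.1⟩
  set L := C₁ * Real.exp (|δ| * c₁) with hL
  have hL0 : 0 ≤ L := by positivity
  let Q : G → G → ℝ := fun a b => if N a ≤ N b ∧ (shadow p o ε a ∩ shadow p o ε b).Nonempty then
    L * (W a * W (a⁻¹ * b)) else 0
  have hQ0 : ∀ a b, 0 ≤ Q a b := by
    intro a b
    simp only [Q]
    split_ifs
    · have := hW0 a
      have := hW0 (a⁻¹ * b)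
      positivity
    · exact le_rfl
  have hQ1 : ∀ a b, N a ≤ N b → μ.real (shadow p o ε a ∩ shadow p o ε b) ≤ Q a b := by
    intro a b hab
    by_cases hne : (shadow p o ε a ∩ shadow p o ε b).Nonempty
    · simp only [Q, hab, hne, and_self, if_true]
      have h1 := hadd a b hne (by simpa using hab)
      have h2 : W b ≤ Real.exp (|δ| * c₁) * (W a * W (a⁻¹ * b)) := by
        simp only [hW]
        rw [← Real.exp_add, ← Real.exp_add]
        refine Real.exp_le_exp.2 ?_
        have h3 : -(δ * (N b - N a - N (a⁻¹ * b))) ≤ |δ| * c₁ := by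
          refine (neg_le_abs _).trans ?_
          rw [abs_mul]
          gcongr
        linarith
      calc μ.real (shadow p o ε a ∩ shadow p o ε b) ≤ μ.real (shadow p o ε b) :=
            measureReal_mono inter_subset_right
        _ ≤ C₁ * W b := hupp b
        _ ≤ C₁ * (Real.exp (|δ| * c₁) * (W a * W (a⁻¹ * b))) := by gcongr
        _ = _ := by rw [hL]; ring
    · rw [not_nonempty_iff_eq_empty.1 hne]
      simpa using hQ0 a b
  have hQsum : ∀ R, ∑ a ∈ T R, ∑ b ∈ T R, Q a b ≤ L * (P R * P (R + c)) := by
    intro R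
    have h1 : ∀ a ∈ T R, ∑ b ∈ T R, Q a b ≤ L * (W a * P (R + c)) := by
      intro a _
      have h2 : ∑ b ∈ T R, Q a b = ∑ b ∈ (T R).filter (fun b => N a ≤ N b ∧
          (shadow p o ε a ∩ shadow p o ε b).Nonempty), L * (W a * W (a⁻¹ * b)) := by
        rw [Finset.sum_filter]
      rw [h2, ← Finset.mul_sum, ← Finset.mul_sum]
      have ha0 := hW0 a
      gcongr
      rw [← Finset.sum_image (s := (T R).filter (fun b => N a ≤ N b ∧
          (shadow p o ε a ∩ shadow p o ε b).Nonempty)) (g := fun b => a⁻¹ * b) (f := W)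
          (fun b _ b' _ hbb => by simpa using hbb)]
      refine Finset.sum_le_sum_of_subset_of_nonneg (fun g hg => ?_) fun g _ _ => (hW0 g).le
      obtain ⟨b, hb, rfl⟩ := Finset.mem_image.1 hg
      obtain ⟨hbR, hab, hne⟩ := Finset.mem_filter.1 hb
      rw [hT] at hbR ⊢
      have h3 := abs_le.1 (hadd a b hne (by simpa using hab))
      have := hcl a
      linarith [h3.1]
    calc ∑ a ∈ T R, ∑ b ∈ T R, Q a b ≤ ∑ a ∈ T R, L * (W a * P (R + c)) := Finset.sum_le_sum h1
      _ = _ := by rw [← Finset.mul_sum, ← Finset.sum_mul]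
  have hPlim : Tendsto (fun n : ℕ => P n) atTop atTop :=
    tendsto_sum_of_not_summable (fun g => (hW0 g).le) hns (fun n g => hT n g)
  have hPle : ∀ R, P R ≤ C₀ * ∑ g ∈ T R, μ.real (shadow p o ε g) := by
    intro R
    rw [Finset.mul_sum]
    exact Finset.sum_le_sum fun g _ => hlow g
  have hC₀pos : (0 : ℝ) < C₀ := by
    have h1 := hlow 1
    have h2 := hW0 1
    by_contra hle
    have h3 : (C₀ : ℝ) = 0 := le_antisymm (not_lt.1 hle) C₀.2
    rw [h3, zero_mul] at h1
    linarith
  refine measure_frequently_mem_ne_zero (fun g => (h.isOpen_shadow ε g).measurableSet)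
    (fun n : ℕ => T n) (C := 4 * L * C₀ ^ 2 + 1) (by positivity) ?_ ?_
  · refine tendsto_atTop_mono (fun n => ?_) (hPlim.const_mul_atTop (inv_pos.2 hC₀pos))
    rw [inv_mul_le_iff₀ hC₀pos]
    exact hPle n
  · filter_upwards [hPlim.eventually (eventually_ge_atTop (max 0 (C₀ * K)))] with n hn
    have hn0 := (le_max_left _ _).trans hn
    have hn1 := (le_max_right _ _).trans hn
    calc ∑ a ∈ T n, ∑ b ∈ T n, μ.real (shadow p o ε a ∩ shadow p o ε b)
        ≤ ∑ a ∈ T n, ∑ b ∈ T n, (Q a b + Q b a) := by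
          refine Finset.sum_le_sum fun a _ => Finset.sum_le_sum fun b _ => ?_
          rcases le_total (N a) (N b) with hab | hab
          · exact (hQ1 a b hab).trans (le_add_of_nonneg_right (hQ0 b a))
          · rw [inter_comm]
            exact (hQ1 b a hab).trans (le_add_of_nonneg_left (hQ0 a b))
      _ = 2 * ∑ a ∈ T n, ∑ b ∈ T n, Q a b := by
          simp_rw [Finset.sum_add_distrib]
          rw [Finset.sum_comm (f := fun a b => Q b a)]
          ring
      _ ≤ 2 * (L * (P n * P (n + c))) := by gcongr; exact hQsum n
      -- Since P n tends to infinity, it eventually absorbs the additive annulus constant C₀ * K.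
      _ ≤ 2 * (L * (P n * (2 * P n))) := by
          gcongr
          have := hPc n
          linarith
      _ = 4 * L * (P n) ^ 2 := by ring
      _ ≤ 4 * L * (C₀ * ∑ g ∈ T n, μ.real (shadow p o ε g)) ^ 2 := by
          gcongr
          exact hPle n
      _ ≤ _ := by
          rw [mul_pow, ← mul_assoc]
          gcongr
          linarith

/-- If the Poincaré series diverges, then the conical limit set has full measure. -/
theorem IsProperMagnitude.measure_compl_conicalSet [IsFiniteMeasure μ]
    (hN : IsProperMagnitude p o σ N) (hμ : IsShadowConformal p o (expWeight δ N) μ)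
    (hfix : ∀ x : M, ∃ a : G, a • x ≠ x)
    (hns : ¬ Summable fun g => Real.exp (-δ * N g)) : μ (conicalSet G p o)ᶜ = 0 := by
  by_contra hne
  -- If ν were nonzero, it would charge a radial set, although it gives no mass to the conical set
  -- containing it.
  set ν := μ.restrict (conicalSet G p o)ᶜ with hν
  have hν0 : ν ≠ 0 := by
    rwa [hν, Ne, Measure.restrict_eq_zero]
  have hνc := hμ.restrict_compl_conicalSet h
  obtain ⟨ε, hε, hsh⟩ := hνc.exists_le_measure_shadow h hν0 hfix
  obtain ⟨C₀, hC₀⟩ := hsh ε hε le_rfl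
  refine hN.measure_radialSet_ne_zero h hνc hns hε hC₀ ?_
  rw [Measure.restrict_apply (h.measurableSet_radialSet ε)]
  convert measure_empty (μ := μ)
  ext x
  simp only [mem_inter_iff, mem_compl_iff, mem_empty_iff_false, iff_false, not_and, not_not]
  exact fun hx => ⟨ε, hε, hx⟩

end
-- Loxodromic elements, absence of global fixed points, properness of the magnitude
section
variable {G M B : Type*} [Group G] [MulAction G M] [MulAction G B]
  [TopologicalSpace M] [CompactSpace M] [MetricSpace B] [CompactSpace B]
  [ContinuousConstSMul G B]

/-- `g` is loxodromic with attracting fixed point `a` and repelling fixed point `b`. -/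
structure IsLox (p : M → B) (o : B) (g : G) (a b : M) : Prop where
  ne : a ≠ b
  smul_attracting : g • a = a
  smul_repelling : g • b = b
  tendsto_cofinite : Tendsto (fun n : ℕ => g ^ n) atTop cofinite
  tendsto_attracting : Tendsto (fun n : ℕ => g ^ n • o) atTop (𝓝 (p a))
  tendsto_repelling : Tendsto (fun n : ℕ => (g ^ n)⁻¹ • o) atTop (𝓝 (p b))

variable {p : M → B} {o : B} {σ : G → M → ℝ} {N : G → ℝ}

omit [CompactSpace M] [CompactSpace B] [ContinuousConstSMul G B] [TopologicalSpace M] in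
theorem IsLox.inv {g : G} {a b : M} (hg : IsLox p o g a b) : IsLox p o g⁻¹ b a := by
  refine ⟨hg.ne.symm, inv_smul_eq_iff.2 hg.smul_repelling.symm,
    inv_smul_eq_iff.2 hg.smul_attracting.symm, ?_, ?_, ?_⟩
  · simpa using tendsto_inv_cofinite hg.tendsto_cofinite
  · simpa using hg.tendsto_repelling
  · simpa using hg.tendsto_attracting

variable (h : IsConvBord (G := G) p o)
include h

theorem IsLox.tendsto_pow_smul {g : G} {a b z : M} (hg : IsLox p o g a b) (hz : z ≠ b) :
    Tendsto (fun n : ℕ => g ^ n • z) atTop (𝓝 a) :=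
  h.tendsto_smul_point hg.tendsto_cofinite hg.tendsto_attracting hg.tendsto_repelling
    tendsto_const_nhds hz

omit [TopologicalSpace M] [CompactSpace M] [MulAction G B] [MetricSpace B] [CompactSpace B]
  [ContinuousConstSMul G B] h in
theorem pow_smul_mem {U V : Set M} (hUV : Disjoint U V) {g : G} (hg : ∀ z ∉ V, g • z ∈ U) {z : M}
    (hz : z ∉ V) {n : ℕ} (hn : n ≠ 0) : g ^ n • z ∈ U := by
  obtain ⟨n, rfl⟩ := Nat.exists_eq_succ_of_ne_zero hn
  clear hn
  induction n with
  | zero => simpa using hg z hz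
  | succ n ih =>
    rw [pow_succ', mul_smul]
    exact hg _ fun hV => hUV.le_bot ⟨ih, hV⟩

/-- Some point outside V differs from b, namely x or w; its forward orbit stays in the closed set U
and converges to a. -/
theorem IsConvBord.mem_of_pow_tendsto {U V : Set M} (hU : IsClosed U) (hUV : Disjoint U V)
    {x w : M} (hx : x ∈ U) (hwU : w ∉ U) (hwV : w ∉ V) {g : G} (hg : ∀ z ∉ V, g • z ∈ U)
    {𝒰 : Ultrafilter ℕ} (h𝒰 : (𝒰 : Filter ℕ) ≤ atTop)
    (hcof : Tendsto (fun n : ℕ => g ^ n) atTop cofinite) {a b : M}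
    (ha : Tendsto (fun n : ℕ => g ^ n • o) 𝒰 (𝓝 (p a)))
    (hb : Tendsto (fun n : ℕ => (g ^ n)⁻¹ • o) 𝒰 (𝓝 (p b))) : a ∈ U := by
  obtain ⟨z, hzV, hzb⟩ : ∃ z ∉ V, z ≠ b := by
    by_cases hxb : x = b
    · exact ⟨w, hwV, fun hwb => hwU (hwb ▸ hxb ▸ hx)⟩
    · exact ⟨x, fun hxV => hUV.le_bot ⟨hx, hxV⟩, hxb⟩
  refine hU.mem_of_tendsto
    (h.tendsto_smul_point (hcof.mono_left h𝒰) ha hb (tendsto_const_nhds (x := z)) hzb) ?_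
  filter_upwards [h𝒰 (eventually_ne_atTop 0)] with n hn
  exact pow_smul_mem hUV hg hzV hn

/-- Both gⁿ • a and gⁿ • (g • a) tend to a, and the second is g applied to the first. -/
theorem IsConvBord.smul_eq_of_pow_tendsto {g : G} {𝒰 : Ultrafilter ℕ}
    (h𝒰 : (𝒰 : Filter ℕ) ≤ atTop) (hcof : Tendsto (fun n : ℕ => g ^ n) atTop cofinite) {a b : M}
    (ha : Tendsto (fun n : ℕ => g ^ n • o) 𝒰 (𝓝 (p a)))
    (hb : Tendsto (fun n : ℕ => (g ^ n)⁻¹ • o) 𝒰 (𝓝 (p b))) (hab : a ≠ b) (hgab : g • a ≠ b) :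
    g • a = a := by
  have := h.t2Space
  have := h.continuousConstSMul
  have h1 := h.tendsto_smul_point (hcof.mono_left h𝒰) ha hb (tendsto_const_nhds (x := a)) hab
  have h2 := h.tendsto_smul_point (hcof.mono_left h𝒰) ha hb (tendsto_const_nhds (x := g • a)) hgab
  refine tendsto_nhds_unique (((continuous_const_smul g).tendsto a).comp h1) (h2.congr fun n => ?_)
  simp only [Function.comp, smul_smul]
  rw [← pow_succ, ← pow_succ']

/-- The ping-pong criterion for being loxodromic. -/
theorem IsConvBord.exists_isLox {U V : Set M} (hU : IsClosed U) (hV : IsClosed V)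
    (hUV : Disjoint U V) {x y w : M} (hx : x ∈ U) (hy : y ∈ V) (hwU : w ∉ U) (hwV : w ∉ V) {g : G}
    (hg : ∀ z ∉ V, g • z ∈ U) : ∃ a ∈ U, ∃ b ∈ V, IsLox p o g a b := by
  have hg' : ∀ z ∉ U, g⁻¹ • z ∈ V := by
    intro z hz
    by_contra hcon
    exact hz (by simpa using hg _ hcon)
  -- The point w outside U and V rules out finite order: every positive power sends it into U.
  have hcof : Tendsto (fun n : ℕ => g ^ n) atTop cofinite := by
    rw [← Nat.cofinite_eq_atTop]
    refine Function.Injective.tendsto_cofinite ?_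
    rw [injective_pow_iff_not_isOfFinOrder, isOfFinOrder_iff_pow_eq_one]
    rintro ⟨n, hn, hgn⟩
    have := pow_smul_mem hUV hg hwV hn.ne'
    rw [hgn, one_smul] at this
    exact hwU this
  have hcof' : Tendsto (fun n : ℕ => g⁻¹ ^ n) atTop cofinite := by
    simpa using tendsto_inv_cofinite hcof
  have key : ∀ 𝒰 : Ultrafilter ℕ, (𝒰 : Filter ℕ) ≤ atTop → ∃ a ∈ U, ∃ b ∈ V,
      Tendsto (fun n : ℕ => g ^ n • o) 𝒰 (𝓝 (p a)) ∧
      Tendsto (fun n : ℕ => (g ^ n)⁻¹ • o) 𝒰 (𝓝 (p b)) ∧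
      g • a = a ∧ g • b = b ∧ ∀ r, g • r = r → r ≠ b → r = a := by
    intro 𝒰 h𝒰
    obtain ⟨a, ha⟩ := h.exists_tendsto_base (hcof.mono_left h𝒰)
    obtain ⟨b, hb⟩ := h.exists_tendsto_base (tendsto_inv_cofinite (hcof.mono_left h𝒰))
    have ha' : Tendsto (fun n : ℕ => g⁻¹ ^ n • o) 𝒰 (𝓝 (p b)) := by simpa using hb
    have hb' : Tendsto (fun n : ℕ => (g⁻¹ ^ n)⁻¹ • o) 𝒰 (𝓝 (p a)) := by simpa using ha
    have haU := h.mem_of_pow_tendsto hU hUV hx hwU hwV hg h𝒰 hcof ha hb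
    have hbV := h.mem_of_pow_tendsto hV hUV.symm hy hwV hwU hg' h𝒰 hcof' ha' hb'
    have hne : ∀ {a b : M}, a ∈ U → b ∈ V → a ≠ b := fun ha hb hab => hUV.le_bot ⟨ha, hab ▸ hb⟩
    refine ⟨a, haU, b, hbV, ha, hb, ?_, ?_, fun r hr hrb => ?_⟩
    · exact h.smul_eq_of_pow_tendsto h𝒰 hcof ha hb (hne haU hbV)
        (hne (hg a fun haV => hne haU haV rfl) hbV)
    · have := h.smul_eq_of_pow_tendsto h𝒰 hcof' ha' hb' (hne haU hbV).symm
        (hne haU (hg' b fun hbU => hne hbU hbV rfl)).symm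
      exact (inv_smul_eq_iff.1 this).symm
    · have := h.t2Space
      have h1 := h.tendsto_smul_point (hcof.mono_left h𝒰) ha hb (tendsto_const_nhds (x := r)) hrb
      refine tendsto_nhds_unique (tendsto_const_nhds.congr fun n => ?_) h1
      induction n with
      | zero => simp
      | succ n ih => rw [pow_succ, mul_smul, hr]; exact ih
  obtain ⟨a, haU, b, hbV, -, -, hga, hgb, hab⟩ := key _ hyperfilter_nat_le_atTop
  have hne : ∀ {a b : M}, a ∈ U → b ∈ V → a ≠ b := fun ha hb hab => hUV.le_bot ⟨ha, hab ▸ hb⟩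
  -- A fixed point of g other than b equals a, so the limits agree along all ultrafilters and the
  -- orbit genuinely converges.
  have huniq : ∀ 𝒰 : Ultrafilter ℕ, (𝒰 : Filter ℕ) ≤ atTop →
      Tendsto (fun n : ℕ => g ^ n • o) 𝒰 (𝓝 (p a)) ∧
      Tendsto (fun n : ℕ => (g ^ n)⁻¹ • o) 𝒰 (𝓝 (p b)) := by
    intro 𝒰 h𝒰
    obtain ⟨a', haU', b', hbV', ha', hb', hga', hgb', hab'⟩ := key 𝒰 h𝒰
    have e1 : a' = a := hab a' hga' (hne haU' hbV)
    have e2 : b' = b := by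
      by_contra hbb
      exact hne haU hbV' (hab b' hgb' hbb).symm
    exact ⟨e1 ▸ ha', e2 ▸ hb'⟩
  exact ⟨a, haU, b, hbV, hne haU hbV, hga, hgb, hcof,
    (tendsto_iff_ultrafilter _ _ _).2 fun 𝒰 h𝒰 => (huniq 𝒰 h𝒰).1,
    (tendsto_iff_ultrafilter _ _ _).2 fun 𝒰 h𝒰 => (huniq 𝒰 h𝒰).2⟩

/-- Elements with distinct attracting and repelling points are eventually loxodromic. -/
theorem IsConvBord.eventually_exists_isLox {ι : Type*} {F : Filter ι} {g : ι → G} {x y w : M}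
    (hg : Tendsto g F cofinite) (hx : Tendsto (fun i => g i • o) F (𝓝 (p x)))
    (hy : Tendsto (fun i => (g i)⁻¹ • o) F (𝓝 (p y))) (hxy : x ≠ y) (hwx : w ≠ x) (hwy : w ≠ y)
    {r : ℝ} (hr : 0 < r) : ∀ᶠ i in F, ∃ a b : M, dist (p a) (p x) ≤ r ∧ dist (p b) (p y) ≤ r ∧
      IsLox p o (g i) a b := by
  have d1 : 0 < dist (p x) (p y) := dist_pos.2 (h.injective.ne hxy)
  have d2 : 0 < dist (p w) (p x) := dist_pos.2 (h.injective.ne hwx)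
  have d3 : 0 < dist (p w) (p y) := dist_pos.2 (h.injective.ne hwy)
  obtain ⟨s, hs, hsr, hs1, hs2, hs3⟩ : ∃ s > 0, s ≤ r ∧ 2 * s < dist (p x) (p y) ∧
      s < dist (p w) (p x) ∧ s < dist (p w) (p y) := by
    refine ⟨min r (min (dist (p x) (p y)) (min (dist (p w) (p x)) (dist (p w) (p y)))) / 3,
      by positivity, ?_⟩
    have e1 := min_le_left r (min (dist (p x) (p y)) (min (dist (p w) (p x)) (dist (p w) (p y))))
    have e2 := min_le_right r (min (dist (p x) (p y)) (min (dist (p w) (p x)) (dist (p w) (p y))))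
    have e3 := min_le_left (dist (p x) (p y)) (min (dist (p w) (p x)) (dist (p w) (p y)))
    have e4 := min_le_right (dist (p x) (p y)) (min (dist (p w) (p x)) (dist (p w) (p y)))
    have e5 := min_le_left (dist (p w) (p x)) (dist (p w) (p y))
    have e6 := min_le_right (dist (p w) (p x)) (dist (p w) (p y))
    refine ⟨?_, ?_, ?_, ?_⟩ <;> linarith
  filter_upwards [hg.eventually (h.contract (s / 2) (by positivity)),
    Metric.tendsto_nhds.1 hx (s / 2) (by positivity),
    Metric.tendsto_nhds.1 hy (s / 2) (by positivity)] with i h1 h2 h3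
  have hcl : ∀ u : M, IsClosed {z | dist (p z) (p u) ≤ s} := fun u =>
    isClosed_le (h.continuous.dist continuous_const) continuous_const
  obtain ⟨a, ha, b, hb, hab⟩ := h.exists_isLox (U := {z | dist (p z) (p x) ≤ s})
    (V := {z | dist (p z) (p y) ≤ s}) (x := x) (y := y) (w := w) (g := g i) (hcl x) (hcl y)
    (by
      refine Set.disjoint_left.2 fun z hz1 hz2 => ?_
      have hz1 : dist (p z) (p x) ≤ s := hz1
      have hz2 : dist (p z) (p y) ≤ s := hz2
      have := dist_triangle_left (p x) (p y) (p z)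
      linarith)
    (by simpa using hs.le) (by simpa using hs.le) (by simpa using hs2) (by simpa using hs3)
    (by
      intro z hz
      have hz : s < dist (p z) (p y) := not_le.1 hz
      have e1 := dist_triangle (p z) ((g i)⁻¹ • o) (p y)
      have e2 := h1 (p z) (by linarith)
      rw [← h.map_smul] at e2
      have e3 := dist_triangle (p (g i • z)) (g i • o) (p x)
      show dist (p (g i • z)) (p x) ≤ s
      linarith)
  have ha : dist (p a) (p x) ≤ s := ha
  have hb : dist (p b) (p y) ≤ s := hb
  exact ⟨a, b, ha.trans hsr, hb.trans hsr, hab⟩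

/-- Loxodromic elements with a common repelling point have the same attracting point. -/
theorem IsLox.attracting_unique {g k : G} {a a' z : M} (hg : IsLox p o g a z)
    (hk : IsLox p o k a' z) : a = a' := by
  by_contra hne
  have := h.t2Space
  have := h.continuousConstSMul
  let 𝒰 := hyperfilter ℕ
  have hr0 : 0 < dist (p a') (p z) := dist_pos.2 (h.injective.ne hk.ne)
  set r := dist (p a') (p z) / 2 with hr
  let v : ℕ → M := fun n => (g ^ n)⁻¹ • a'
  have hv : Tendsto v atTop (𝓝 z) := by
    have := hg.inv.tendsto_pow_smul h (Ne.symm hne)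
    simpa using this
  have hpow : ∀ {g : G} {a : M} (n : ℕ), g • a = a → g ^ n • a = a := by
    intro g a n hga
    induction n with
    | zero => simp
    | succ n ih => rw [pow_succ, mul_smul, hga, ih]
  have hvz : ∀ n, v n ≠ z := by
    intro n hvn
    apply hk.ne
    have : a' = g ^ n • z := inv_smul_eq_iff.1 hvn
    rw [this, hpow n hg.smul_repelling]
  have hfar : ∀ n, ∃ j : ℕ, r ≤ dist (p (k ^ j • v n)) (p z) := by
    intro n
    have h1 := (h.continuous.tendsto a').comp (hk.tendsto_pow_smul h (hvz n))
    obtain ⟨j, hj⟩ := ((h1.dist (tendsto_const_nhds (x := p z))).eventually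
      (lt_mem_nhds (show r < dist (p a') (p z) by linarith))).exists
    exact ⟨j, hj.le⟩
  classical
  -- The points v n are pulled towards z by g⁻ⁿ, then pushed out by k until they first leave the
  -- r-ball about z. The elements u n = k ^ j n * g⁻ⁿ send a, z, a' towards a', z and a limit s.
  -- Once these limits are known to be distinct, an escaping u n would contradict the convergence
  -- property, which allows one exception only.
  let j : ℕ → ℕ := fun n => Nat.find (hfar n)
  have hj : ∀ n, r ≤ dist (p (k ^ j n • v n)) (p z) := fun n => Nat.find_spec (hfar n)
  have hjlim : Tendsto j atTop atTop := by
    rw [tendsto_atTop]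
    intro m
    have h1 : ∀ i ∈ Finset.range m, ∀ᶠ n in atTop, dist (p (k ^ i • v n)) (p z) < r := by
      intro i _
      have h2 : Tendsto (fun n => k ^ i • v n) atTop (𝓝 (k ^ i • z)) :=
        ((continuous_const_smul (k ^ i)).tendsto z).comp hv
      rw [hpow i hk.smul_repelling] at h2
      exact Metric.tendsto_nhds.1 ((h.continuous.tendsto z).comp h2) r (by positivity)
    filter_upwards [(Finset.eventually_all _).2 h1] with n hn
    by_contra hlt
    exact absurd (hj n) (not_le.2 (hn (j n) (Finset.mem_range.2 (not_le.1 hlt))))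
  let u : ℕ → G := fun n => k ^ j n * (g ^ n)⁻¹
  have hua : ∀ n, u n • a = k ^ j n • a := by
    intro n
    simp only [u, mul_smul]
    rw [inv_smul_eq_iff.2 (hpow n hg.smul_attracting).symm]
  have huz : ∀ n, u n • z = z := by
    intro n
    simp only [u, mul_smul]
    rw [inv_smul_eq_iff.2 (hpow n hg.smul_repelling).symm, hpow _ hk.smul_repelling]
  have hualim : Tendsto (fun n => u n • a) 𝒰 (𝓝 a') := by
    simp_rw [hua]
    exact ((hk.tendsto_pow_smul h hg.ne).comp hjlim).mono_left hyperfilter_nat_le_atTop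
  obtain ⟨s, hs⟩ := ultrafilter_exists_tendsto 𝒰 (fun n => u n • a')
  have hsz : s ≠ z := by
    rintro rfl
    have h1 : r ≤ dist (p s) (p s) := by
      refine ge_of_tendsto (((h.continuous.tendsto s).comp hs).dist tendsto_const_nhds)
        (Eventually.of_forall fun n => ?_)
      simpa [u, v, mul_smul] using hj n
    rw [dist_self] at h1
    linarith
  -- By minimality of j n, one application of k⁻¹ to k ^ j n • v n returns to the r-ball about z. If
  -- s were the fixed point a' of k, this would put a' within r of z, whereas its distance is 2r.
  have hsa : s ≠ a' := by
    intro hsa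
    have h1 : Tendsto (fun n => k⁻¹ • u n • a') 𝒰 (𝓝 (k⁻¹ • s)) :=
      ((continuous_const_smul k⁻¹).tendsto s).comp hs
    rw [hsa, inv_smul_eq_iff.2 hk.smul_attracting.symm] at h1
    have h2 : dist (p a') (p z) ≤ r := by
      refine le_of_tendsto (((h.continuous.tendsto a').comp h1).dist tendsto_const_nhds) ?_
      filter_upwards [hyperfilter_nat_le_atTop (hjlim.eventually (eventually_ge_atTop 1))] with n hn
      have h3 := Nat.find_min (hfar n) (m := j n - 1)
        (Nat.sub_lt (show 0 < j n from hn) one_pos)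
      have h4 : k⁻¹ • u n • a' = k ^ (j n - 1) • v n := by
        obtain ⟨i, hi⟩ := Nat.exists_eq_add_of_le' (show 1 ≤ j n from hn)
        simp only [u, v, hi, mul_smul, pow_succ', Nat.add_sub_cancel, inv_smul_smul]
      simp only [Function.comp, h4]
      exact (not_le.1 h3).le
    linarith
  rcases ultrafilter_eventually_eq_or_tendsto 𝒰 u with ⟨u₀, hu₀⟩ | hu
  · have h1 : u₀ • a = a' :=
      tendsto_nhds_unique (tendsto_const_nhds.congr' (hu₀.mono fun n hn => by rw [hn])) hualim
    obtain ⟨n, hn⟩ := hu₀.exists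
    rw [← hn, hua] at h1
    exact hne (MulAction.injective (k ^ j n) (h1.trans (hpow _ hk.smul_attracting).symm))
  · obtain ⟨x, hx⟩ := h.exists_tendsto_base hu
    obtain ⟨y, hy⟩ := h.exists_tendsto_base (tendsto_inv_cofinite hu)
    have hlim : ∀ {q l : M}, Tendsto (fun n => u n • q) 𝒰 (𝓝 l) → q ≠ y → l = x := fun hq hqy =>
      tendsto_nhds_unique hq (h.tendsto_smul_point hu hx hy tendsto_const_nhds hqy)
    have huz' : Tendsto (fun n => u n • z) 𝒰 (𝓝 z) := by simp_rw [huz]; exact tendsto_const_nhds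
    by_cases hay : a = y
    · exact hsz ((hlim hs (fun e => hne (hay.trans e.symm))).trans
        (hlim huz' (fun e => hg.ne (hay.trans e.symm))).symm)
    by_cases hzy : z = y
    · exact hsa ((hlim hs (fun e => hk.ne (e.trans hzy.symm))).trans (hlim hualim hay).symm)
    · exact hk.ne ((hlim hualim hay).trans (hlim huz' hzy).symm)

/-- A non-elementary convergence group has no global fixed point. -/
theorem IsConvBord.exists_smul_ne {x₁ x₂ x₃ : M} (h12 : x₁ ≠ x₂) (h13 : x₁ ≠ x₃) (h23 : x₂ ≠ x₃)
    (hlim : ∀ x, x = x₁ ∨ x = x₂ ∨ x = x₃ → ∃ s : ℕ → G, Tendsto s (hyperfilter ℕ) cofinite ∧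
      Tendsto (fun n => s n • o) (hyperfilter ℕ) (𝓝 (p x))) (z : M) : ∃ g : G, g • z ≠ z := by
  by_contra! hz
  have := h.t2Space
  -- With z globally fixed, z must be the repelling point, so every limit point x ≠ z is
  -- approximated by attracting points of loxodromics repelling from z. By `attracting_unique` those
  -- attracting points coincide, leaving at most one limit point besides z.
  have hlox : ∀ x, x = x₁ ∨ x = x₂ ∨ x = x₃ → x ≠ z → ∀ r > 0, ∃ (g : G) (a : M),
      dist (p a) (p x) ≤ r ∧ IsLox p o g a z := by
    intro x hx hxz r hr
    obtain ⟨s, hs, hsx⟩ := hlim x hx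
    obtain ⟨y, hy⟩ := h.exists_tendsto_base (tendsto_inv_cofinite hs)
    have hzy : z = y := by
      by_contra hzy
      have h1 := h.tendsto_smul_point hs hsx hy (tendsto_const_nhds (x := z)) hzy
      simp_rw [hz] at h1
      exact hxz (tendsto_nhds_unique h1 tendsto_const_nhds)
    subst hzy
    obtain ⟨w, hwx, hwz⟩ : ∃ w, w ≠ x ∧ w ≠ z := by
      by_contra! hcon
      by_cases e1 : x₁ = x
      · have e2 := hcon x₂ (fun e => h12 (e1.trans e.symm))
        have e3 := hcon x₃ (fun e => h13 (e1.trans e.symm))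
        exact h23 (e2.trans e3.symm)
      · have e2 := hcon x₁ e1
        by_cases e3 : x₂ = x
        · exact h13 (e2.trans (hcon x₃ (fun e => h23 (e3.trans e.symm))).symm)
        · exact h12 (e2.trans (hcon x₂ e3).symm)
    have hd : 0 < dist (p x) (p z) := dist_pos.2 (h.injective.ne hxz)
    obtain ⟨n, a, b, ha, hb, hab⟩ := (h.eventually_exists_isLox hs hsx hy hxz hwx hwz
      (r := min r (dist (p x) (p z) / 2)) (by positivity)).exists
    refine ⟨s n, a, ha.trans (min_le_left _ _), ?_⟩
    by_cases hbz : z = b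
    · rwa [hbz]
    · exfalso
      have h1 := hab.tendsto_pow_smul h hbz
      simp_rw [hz] at h1
      rw [← tendsto_nhds_unique tendsto_const_nhds h1, dist_comm] at ha
      have := ha.trans (min_le_right _ _)
      linarith
  have key : ∀ x y, (x = x₁ ∨ x = x₂ ∨ x = x₃) → (y = x₁ ∨ y = x₂ ∨ y = x₃) → x ≠ z → y ≠ z →
      x = y := by
    intro x y hx hy hxz hyz
    by_contra hxy
    have hd : 0 < dist (p x) (p y) := dist_pos.2 (h.injective.ne hxy)
    obtain ⟨g, a, ha, hg⟩ := hlox x hx hxz (dist (p x) (p y) / 3) (by positivity)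
    obtain ⟨k, a', ha', hk⟩ := hlox y hy hyz (dist (p x) (p y) / 3) (by positivity)
    rw [← hg.attracting_unique h hk] at ha'
    have := dist_triangle_left (p x) (p y) (p a)
    linarith
  by_cases e1 : x₁ = z
  · exact h23 (key x₂ x₃ (by simp) (by simp) (fun e => h12 (e1.trans e.symm))
      (fun e => h13 (e1.trans e.symm)))
  · by_cases e2 : x₂ = z
    · exact h13 (key x₁ x₃ (by simp) (by simp) e1 (fun e => h23 (e2.trans e.symm)))
    · exact h12 (key x₁ x₂ (by simp) (by simp) e1 e2)

/-- Properness along loxodromic elements implies that the magnitude is proper. -/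
theorem IsConvBord.isProperMagnitude (hfix : ∀ x : M, ∃ a : G, a • x ≠ x)
    (hthird : ∀ x y : M, ∃ w, w ≠ x ∧ w ≠ y)
    (hcoc : ∃ κ : ℝ, ∀ (g k : G) (x : M), |σ (g * k) x - (σ g (k • x) + σ k x)| ≤ κ)
    (hmag : ∀ ε > 0, ∃ C : ℝ, ∀ (x : M) (g : G), ε < dist (p x) (g⁻¹ • o) → |σ g x - N g| ≤ C)
    (hprop : ∀ (γ : ℕ → G) (a b : ℕ → M), Function.Injective γ →
      (∀ n, IsLox p o (γ n) (a n) (b n)) → (∃ c > 0, ∀ᶠ n in atTop, c ≤ dist (p (b n)) (p (a n))) →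
      Tendsto (fun n => σ (γ n) (a n)) atTop atTop) : IsProperMagnitude p o σ N := by
  refine ⟨hcoc, hmag, ?_⟩
  rw [tendsto_atTop]
  intro R
  by_contra hcon
  have hinf : {g | ¬ R ≤ N g}.Infinite := fun hfin => hcon (Filter.eventually_cofinite.2 hfin)
  let s : ℕ → G := fun n => (hinf.natEmbedding _ n : G)
  have hsinj : Function.Injective s := fun i j hij => (hinf.natEmbedding _).injective (Subtype.ext hij)
  have hsR : ∀ n, N (s n) < R := fun n => not_le.1 (hinf.natEmbedding _ n).2
  have hs : Tendsto s (hyperfilter ℕ) cofinite :=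
    hsinj.tendsto_cofinite.mono_left hyperfilter_le_cofinite
  obtain ⟨x, hx⟩ := h.exists_tendsto_base hs
  obtain ⟨y, hy⟩ := h.exists_tendsto_base (tendsto_inv_cofinite hs)
  -- The elements s n need not be loxodromic; left translation by a fixed f separates the attracting
  -- and repelling limits. It makes f * s n loxodromic with well separated fixed points, and changes
  -- σ only by a bounded amount.
  obtain ⟨f, hf⟩ : ∃ f : G, f • x ≠ y := by
    by_cases hxy : x = y
    · obtain ⟨f, hf⟩ := hfix x
      exact ⟨f, hxy ▸ hf⟩
    · exact ⟨1, by simpa using hxy⟩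
  have hfs := tendsto_mul_left_cofinite f hs
  have hfx : Tendsto (fun n => (f * s n) • o) (hyperfilter ℕ) (𝓝 (p (f • x))) := by
    rw [h.map_smul]
    exact tendsto_mul_smul_base f hx
  have hfy : Tendsto (fun n => (f * s n)⁻¹ • o) (hyperfilter ℕ) (𝓝 (p y)) := by
    simpa using h.tendsto_mul_right_base f⁻¹ (tendsto_inv_cofinite hs) hy
  obtain ⟨w, hw1, hw2⟩ := hthird (f • x) y
  have hd : 0 < dist (p (f • x)) (p y) := dist_pos.2 (h.injective.ne hf)
  set r := dist (p (f • x)) (p y) / 4 with hr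
  have hev : ∀ᶠ n in (hyperfilter ℕ : Filter ℕ), (∃ a b : M, r ≤ dist (p b) (p a) ∧
      r < dist (p a) ((s n)⁻¹ • o) ∧ IsLox p o (f * s n) a b) := by
    filter_upwards [h.eventually_exists_isLox hfs hfx hfy hf hw1 hw2 (r := r) (by positivity),
      Metric.tendsto_nhds.1 hy r (by positivity)] with n ⟨a, b, ha, hb, hab⟩ hn
    refine ⟨a, b, ?_, ?_, hab⟩
    · have e1 := dist_triangle4 (p (f • x)) (p a) (p b) (p y)
      rw [dist_comm (p (f • x)) (p a), dist_comm (p a) (p b)] at e1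
      linarith
    · have e1 := dist_triangle4 (p (f • x)) (p a) ((s n)⁻¹ • o) (p y)
      rw [dist_comm (p (f • x)) (p a)] at e1
      linarith
  have hfreq : ∃ᶠ n in atTop, (∃ a b : M, r ≤ dist (p b) (p a) ∧
      r < dist (p a) ((s n)⁻¹ • o) ∧ IsLox p o (f * s n) a b) :=
    hev.frequently.filter_mono hyperfilter_nat_le_atTop
  obtain ⟨φ, hφ, hφlox⟩ := extraction_of_frequently_atTop hfreq
  choose a b hab has hlox using hφlox
  have hlim := hprop (fun n => f * s (φ n)) a b
    ((mul_right_injective f).comp (hsinj.comp hφ.injective)) hlox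
    ⟨r, by positivity, Eventually.of_forall hab⟩
  obtain ⟨κ, hκ⟩ := hcoc
  obtain ⟨C, hC⟩ := hmag r (by positivity)
  obtain ⟨ε, hε, hεf⟩ := h.exists_dist_base_ge f⁻¹
  obtain ⟨C', hC'⟩ := hmag ε hε
  obtain ⟨n, hn⟩ := (hlim.eventually (eventually_gt_atTop (κ + (N f + C') + (R + C)))).exists
  have e1 := abs_le.1 (hκ f (s (φ n)) (a n))
  have e2 := abs_le.1 (hC _ _ (has n))
  have e3 := abs_le.1 (hC' (s (φ n) • a n) f (hεf _))
  have e4 := hsR (φ n)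
  linarith [e1.2, e2.2, e3.2]

end

/-! ### From compatible metrics and Patterson–Sullivan measures to the abstract setting -/

/-- Distances to the orbit of the base point are controlled independently of the metric. -/
theorem IsConvBord.exists_dist_lt {G M B B' : Type*} [Group G] [MulAction G M] [MulAction G B]
    [TopologicalSpace M] [CompactSpace M] [MetricSpace B] [CompactSpace B]
    [ContinuousConstSMul G B] [MulAction G B'] [MetricSpace B'] [CompactSpace B']
    [ContinuousConstSMul G B'] {p : M → B} {o : B} {p' : M → B'} {o' : B'}
    (h : IsConvBord (G := G) p o) (h' : IsConvBord (G := G) p' o')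
    (hthird : ∀ x y : M, ∃ w, w ≠ x ∧ w ≠ y) {ε : ℝ} (hε : 0 < ε) :
    ∃ ε' > 0, ∀ (x : M) (g : G), ε < dist (p x) (g • o) → ε' < dist (p' x) (g • o') := by
  by_contra! hcon
  choose x g hx hg using fun n : ℕ => hcon (1 / ((n : ℝ) + 1)) (by positivity)
  let 𝒰 := hyperfilter ℕ
  have := h.t2Space
  obtain ⟨x₀, hx₀⟩ := ultrafilter_exists_tendsto 𝒰 x
  have hpx := (h.continuous.tendsto x₀).comp hx₀
  have hpx' := (h'.continuous.tendsto x₀).comp hx₀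
  have hg' : Tendsto (fun n => g n • o') 𝒰 (𝓝 (p' x₀)) := by
    rw [Metric.tendsto_nhds]
    intro r hr
    filter_upwards [Metric.tendsto_nhds.1 hpx' (r / 2) (by positivity),
      eventually_hyperfilter_one_div_lt (show 0 < r / 2 by positivity)] with n h1 h2
    have h3 := hg n
    have := dist_triangle_left (g n • o') (p' x₀) (p' (x n))
    simp only [Function.comp] at h1
    linarith
  rcases ultrafilter_eventually_eq_or_tendsto 𝒰 g with ⟨g₀, hg₀⟩ | hgc
  · exact h'.smul_base_ne g₀ x₀ (tendsto_nhds_unique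
      (tendsto_const_nhds.congr' (hg₀.mono fun n hn => by simp [hn])) hg')
  · obtain ⟨y, hy⟩ := h.exists_tendsto_base hgc
    obtain ⟨z, hz⟩ := h.exists_tendsto_base (tendsto_inv_cofinite hgc)
    obtain ⟨z', hz'⟩ := h'.exists_tendsto_base (tendsto_inv_cofinite hgc)
    -- A point w avoiding the repelling limits of both compactifications identifies the attracting
    -- limits: g n • w tends to both in M.
    obtain ⟨w, hw, hw'⟩ := hthird z z'
    have e1 := h.tendsto_smul_point hgc hy hz (tendsto_const_nhds (x := w)) hw
    have e2 := h'.tendsto_smul_point hgc hg' hz' (tendsto_const_nhds (x := w)) hw'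
    rw [tendsto_nhds_unique e1 e2] at hy
    have h1 : ε ≤ dist (p x₀) (p x₀) :=
      ge_of_tendsto (hpx.dist hy) (Eventually.of_forall fun n => (hx n).le)
    rw [dist_self] at h1
    linarith

section
variable {M : Type*} [TopologicalSpace M]

/-- The tautological action, as a `MulAction`. -/
instance homeoMulAction (Γ : Subgroup (M ≃ₜ M)) : MulAction Γ M where
  smul := homeoAct Γ
  one_smul _ := rfl
  mul_smul _ _ _ := rfl

/-- The action on the bordification, as a `MulAction`. -/
instance bordMulAction (Γ : Subgroup (M ≃ₜ M)) : MulAction Γ (Bordification Γ) where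
  smul := bordAct Γ
  one_smul x := by
    rcases x with x | x
    · exact congrArg Sum.inl (one_mul x)
    · rfl
  mul_smul g k x := by
    rcases x with x | x
    · exact congrArg Sum.inl (mul_assoc g k x)
    · rfl

theorem smul_ofGroup (Γ : Subgroup (M ≃ₜ M)) (g k : Γ) : g • ofGroup Γ k = ofGroup Γ (g * k) := rfl

theorem smul_ofGroup_one (Γ : Subgroup (M ≃ₜ M)) (g : Γ) : g • ofGroup Γ 1 = ofGroup Γ g := by
  rw [smul_ofGroup, mul_one]

theorem smul_ofPoint (Γ : Subgroup (M ≃ₜ M)) (g : Γ) (x : M) :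
    ofPoint Γ (g • x) = g • ofPoint Γ x := rfl

variable [CompactSpace M]

/-- A compatible metric makes the bordification a convergence bordification. -/
theorem isConvBord_of_isCompatibleMetric (Γ : Subgroup (M ≃ₜ M)) [d : MetricSpace (Bordification Γ)]
    (hd : IsCompatibleMetric Γ d) {m₁ m₂ : M} (hm : m₁ ≠ m₂) :
    CompactSpace (Bordification Γ) ∧ ContinuousConstSMul Γ (Bordification Γ) ∧
      IsConvBord (G := Γ) (ofPoint Γ) (ofGroup Γ 1) := by
  have hcomp : CompactSpace (Bordification Γ) := hd.compact
  have hcont : ContinuousConstSMul Γ (Bordification Γ) := ⟨fun g => hd.convergence.1 g⟩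
  have hemb : IsEmbedding (ofPoint Γ) := hd.isEmbedding_ofPoint
  have hinj : Function.Injective (ofPoint Γ) := hemb.injective
  have hclosed : IsClosed (range (ofPoint Γ)) := (isCompact_range hemb.continuous).isClosed
  have hiso : ∀ g : Γ, IsOpen ({ofGroup Γ g} : Set (Bordification Γ)) := by
    intro g
    let _ : TopologicalSpace Γ := ⊥
    have hembG : IsEmbedding (ofGroup Γ) := hd.isEmbedding_ofGroup
    have : DiscreteTopology Γ := ⟨rfl⟩
    obtain ⟨V, hV, hVg⟩ := hembG.isOpen_iff.1 (isOpen_discrete ({g} : Set Γ))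
    have : ({ofGroup Γ g} : Set (Bordification Γ)) = V ∩ (range (ofPoint Γ))ᶜ := by
      ext x
      simp only [mem_singleton_iff, mem_inter_iff, mem_compl_iff, mem_range, not_exists]
      constructor
      · rintro rfl
        refine ⟨?_, fun y hy => by cases hy⟩
        have : g ∈ ofGroup Γ ⁻¹' V := by rw [hVg]; rfl
        exact this
      · rintro ⟨hxV, hx⟩
        rcases x with k | y
        · have : k ∈ ofGroup Γ ⁻¹' V := hxV
          rw [hVg] at this
          rw [mem_singleton_iff.1 this]
          rfl
        · exact absurd rfl (hx y)
    rw [this]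
    exact hV.inter hclosed.isOpen_compl
  have hescape : ∀ (𝒰 : Ultrafilter ℕ) (s : ℕ → Γ), (𝒰 : Filter ℕ) ≤ cofinite →
      Function.Injective s → ∀ k : Γ, ¬ Tendsto (fun n => ofGroup Γ (s n)) 𝒰 (𝓝 (ofGroup Γ k)) := by
    intro 𝒰 s h𝒰 hs k hk
    have h1 : ∀ᶠ n in (𝒰 : Filter ℕ), ofGroup Γ (s n) = ofGroup Γ k :=
      hk ((hiso k).mem_nhds rfl)
    have h2 : ∀ᶠ n in (𝒰 : Filter ℕ), s n ≠ k :=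
      (hs.tendsto_cofinite.mono_left h𝒰).eventually (eventually_cofinite_ne k)
    obtain ⟨n, hn1, hn2⟩ := (h1.and h2).exists
    exact hn2 (Sum.inl.inj hn1)
  refine ⟨hcomp, hcont, hemb.continuous, hinj, smul_ofPoint Γ, ?_, ?_, ?_⟩
  · rintro ⟨x, hx⟩
    cases hx
  · intro ε hε
    by_contra hcon
    have hinf : {g : Γ | ¬ ∀ z : Bordification Γ, ε ≤ dist z (g⁻¹ • ofGroup Γ 1) →
        dist (g • z) (g • ofGroup Γ 1) < ε}.Infinite :=
      fun hfin => hcon (Filter.eventually_cofinite.2 hfin)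
    let t : ℕ → Γ := fun n => (hinf.natEmbedding _ n : Γ)
    have htinj : Function.Injective t := fun i j hij =>
      (hinf.natEmbedding _).injective (Subtype.ext hij)
    have htbad : ∀ n, ∃ z : Bordification Γ, ε ≤ dist z ((t n)⁻¹ • ofGroup Γ 1) ∧
        ε ≤ dist (t n • z) (t n • ofGroup Γ 1) := by
      intro n
      have h1 : ¬ ∀ z : Bordification Γ, ε ≤ dist z ((t n)⁻¹ • ofGroup Γ 1) →
        dist (t n • z) (t n • ofGroup Γ 1) < ε := (hinf.natEmbedding _ n).2
      push Not at h1
      exact h1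
    obtain ⟨x, y, φ, hφ, hconv⟩ := hd.convergence.2 t htinj
    let s : ℕ → Γ := fun n => t (φ n)
    have hs : Function.Injective s := htinj.comp hφ.injective
    have hconv : ∀ K : Set (Bordification Γ), IsCompact K → y ∉ K → ∀ U ∈ 𝓝 x,
        ∀ᶠ n in atTop, ∀ z ∈ K, s n • z ∈ U := hconv
    choose z hz1 hz2 using fun n => htbad (φ n)
    let 𝒰 := hyperfilter ℕ
    have hconv' : ∀ (v : ℕ → Bordification Γ) (l : Bordification Γ), l ≠ y → Tendsto v 𝒰 (𝓝 l) →
        Tendsto (fun n => s n • v n) 𝒰 (𝓝 x) := by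
      intro v l hly hv U hU
      have hr : 0 < dist l y := dist_pos.2 hly
      have h1 := hconv (Metric.closedBall l (dist l y / 2))
        (Metric.isClosed_closedBall.isCompact) (by
          rw [Metric.mem_closedBall, dist_comm]
          linarith) U hU
      have h2 : ∀ᶠ n in (𝒰 : Filter ℕ), v n ∈ Metric.closedBall l (dist l y / 2) :=
        hv (Metric.closedBall_mem_nhds l (half_pos hr))
      show ∀ᶠ n in (𝒰 : Filter ℕ), s n • v n ∈ U
      filter_upwards [hyperfilter_nat_le_atTop h1, h2] with n hn1 hn2
      exact hn1 _ hn2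
    -- Otherwise the compact invariant set M avoids y and is pushed into every neighbourhood of x,
    -- so M would be a single point.
    have hyM : y ∈ range (ofPoint Γ) := by
      by_contra hyM
      have h1 : ∀ m : M, ofPoint Γ m = x := by
        intro m
        by_contra hmx
        have h2 := hconv _ (isCompact_range hemb.continuous) hyM _
          (isOpen_compl_singleton.mem_nhds (Ne.symm hmx))
        obtain ⟨n, hn⟩ := h2.exists
        have h3 := hn (ofPoint Γ ((s n)⁻¹ • m)) ⟨_, rfl⟩
        rw [← smul_ofPoint, smul_inv_smul] at h3
        exact h3 rfl
      exact hm (hinj ((h1 m₁).trans (h1 m₂).symm))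
    have hoy : ofGroup Γ 1 ≠ y := by
      rintro rfl
      obtain ⟨w, hw⟩ := hyM
      cases hw
    have hx := hconv' _ _ hoy tendsto_const_nhds
    obtain ⟨y', hy'⟩ := ultrafilter_exists_tendsto 𝒰 (fun n => (s n)⁻¹ • ofGroup Γ 1)
    -- If (s n)⁻¹ • o accumulated elsewhere, applying s n would show x = o, although s n • o tends
    -- to x and leaves every isolated group point.
    have hyy : y' = y := by
      by_contra hne
      have h1 := hconv' _ _ hne hy'
      simp only [smul_inv_smul] at h1
      have h2 := tendsto_nhds_unique h1 tendsto_const_nhds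
      rw [h2] at hx
      simp only [smul_ofGroup_one] at hx
      exact hescape 𝒰 s hyperfilter_le_cofinite hs 1 hx
    obtain ⟨l, hl⟩ := ultrafilter_exists_tendsto 𝒰 z
    have hly : l ≠ y := by
      rintro rfl
      have h1 : ε ≤ dist l y' := ge_of_tendsto (hl.dist hy') (Eventually.of_forall fun n => hz1 n)
      rw [hyy, dist_self] at h1
      linarith
    have h2 : ε ≤ dist x x :=
      ge_of_tendsto ((hconv' _ _ hly hl).dist hx) (Eventually.of_forall fun n => hz2 n)
    rw [dist_self] at h2
    linarith
  · intro ε hε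
    by_contra hcon
    have hinf : {g : Γ | ¬ ∃ x : M, dist (g • ofGroup Γ 1) (ofPoint Γ x) < ε}.Infinite :=
      fun hfin => hcon (Filter.eventually_cofinite.2 hfin)
    let s : ℕ → Γ := fun n => (hinf.natEmbedding _ n : Γ)
    have hs : Function.Injective s := fun i j hij =>
      (hinf.natEmbedding _).injective (Subtype.ext hij)
    have hbad : ∀ n, ¬ ∃ x : M, dist (s n • ofGroup Γ 1) (ofPoint Γ x) < ε :=
      fun n => (hinf.natEmbedding _ n).2
    obtain ⟨l, hl⟩ := ultrafilter_exists_tendsto (hyperfilter ℕ) (fun n => ofGroup Γ (s n))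
    rcases l with k | x
    · exact hescape _ s hyperfilter_le_cofinite hs k hl
    · obtain ⟨n, hn⟩ := (Metric.tendsto_nhds.1 hl ε hε).exists
      refine hbad n ⟨x, ?_⟩
      rw [smul_ofGroup_one]
      exact hn

theorem IsLox.isLoxodromic {Γ : Subgroup (M ≃ₜ M)} [MetricSpace (Bordification Γ)]
    [CompactSpace (Bordification Γ)] [ContinuousConstSMul Γ (Bordification Γ)]
    (h : IsConvBord (G := Γ) (ofPoint Γ) (ofGroup Γ 1)) {g : Γ} {a b : M}
    (hg : IsLox (ofPoint Γ) (ofGroup Γ 1) g a b) : IsLoxodromic Γ g a b :=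
  ⟨hg.ne, hg.smul_attracting, hg.smul_repelling,
    h.convergesOffPoint hg.tendsto_cofinite hg.tendsto_attracting hg.tendsto_repelling,
    h.convergesOffPoint hg.inv.tendsto_cofinite hg.inv.tendsto_attracting hg.inv.tendsto_repelling⟩

/-- Points of the limit set are limits of the orbit of the base point. -/
theorem exists_tendsto_of_mem_limitSet {Γ : Subgroup (M ≃ₜ M)} [MetricSpace (Bordification Γ)]
    [CompactSpace (Bordification Γ)] [ContinuousConstSMul Γ (Bordification Γ)]
    (h : IsConvBord (G := Γ) (ofPoint Γ) (ofGroup Γ 1)) (hthird : ∀ x y : M, ∃ w, w ≠ x ∧ w ≠ y)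
    {x : M} (hx : x ∈ limitSet Γ) : ∃ s : ℕ → Γ, Tendsto s (hyperfilter ℕ) cofinite ∧
      Tendsto (fun n => s n • ofGroup Γ 1) (hyperfilter ℕ) (𝓝 (ofPoint Γ x)) := by
  have := h.t2Space
  obtain ⟨y, s, hs⟩ := hx
  have hlim : ∀ w, w ≠ y → Tendsto (fun n => s n • w) (hyperfilter ℕ) (𝓝 x) := by
    intro w hw U hU
    refine hyperfilter_nat_le_atTop ?_
    filter_upwards [hs {w} isCompact_singleton (by simpa using hw.symm) U hU] with n hn
    exact hn rfl
  have hcof : Tendsto s (hyperfilter ℕ) cofinite := by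
    -- The sequence in the definition of `limitSet` may repeat elements, but a homeomorphism cannot
    -- collapse M minus a point, which has at least two points here.
    rcases ultrafilter_eventually_eq_or_tendsto (hyperfilter ℕ) s with ⟨g, hg⟩ | hs
    · exfalso
      have hgw : ∀ w, w ≠ y → g • w = x := fun w hw =>
        tendsto_nhds_unique (tendsto_const_nhds.congr' (hg.mono fun n hn => by rw [hn])) (hlim w hw)
      obtain ⟨w, hwy, -⟩ := hthird y y
      obtain ⟨w', hwy', hww'⟩ := hthird y w
      exact hww' (MulAction.injective g ((hgw w' hwy').trans (hgw w hwy).symm))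
    · exact hs
  obtain ⟨x', hx'⟩ := h.exists_tendsto_base hcof
  obtain ⟨y', hy'⟩ := h.exists_tendsto_base (tendsto_inv_cofinite hcof)
  obtain ⟨w, hw, hw'⟩ := hthird y y'
  have := h.tendsto_smul_point hcof hx' hy' (tendsto_const_nhds (x := w)) hw'
  rw [tendsto_nhds_unique this (hlim w hw)] at hx'
  exact ⟨s, hcof, hx'⟩

theorem IsMagnitudeFor.abs_sub_le {Γ : Subgroup (M ≃ₜ M)} {d : MetricSpace (Bordification Γ)}
    {σ : Γ → M → ℝ} {N : Γ → ℝ} (hN : IsMagnitudeFor Γ d σ N) : ∀ ε > 0, ∃ C : ℝ,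
      ∀ (x : M) (g : Γ), ε < dist (ofPoint Γ x) (g⁻¹ • ofGroup Γ 1) → |σ g x - N g| ≤ C := by
  intro ε hε
  obtain ⟨C, -, hC⟩ := hN ε hε
  refine ⟨C, fun x g hx => ?_⟩
  rw [smul_ofGroup_one] at hx
  have := hC x g hx
  rw [abs_le]
  constructor <;> linarith [this.1, this.2]

theorem exists_dist_lt_of_isCompatibleMetric {Γ : Subgroup (M ≃ₜ M)}
    (d d' : MetricSpace (Bordification Γ)) (hd : IsCompatibleMetric Γ d)
    (hd' : IsCompatibleMetric Γ d') (hthird : ∀ x y : M, ∃ w, w ≠ x ∧ w ≠ y)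
    {m₁ m₂ : M} (hm : m₁ ≠ m₂) {ε : ℝ} (hε : 0 < ε) : ∃ ε' > 0, ∀ (x : M) (g : Γ),
      ε < d.dist (ofPoint Γ x) (g • ofGroup Γ 1) → ε' < d'.dist (ofPoint Γ x) (g • ofGroup Γ 1) := by
  have h := @isConvBord_of_isCompatibleMetric M _ _ Γ d hd m₁ m₂ hm
  have h' := @isConvBord_of_isCompatibleMetric M _ _ Γ d' hd' m₁ m₂ hm
  exact @IsConvBord.exists_dist_lt Γ M (Bordification Γ) (Bordification Γ) _ _ _ _ _ d h.1 h.2.1 _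
    d' h'.1 h'.2.1 _ _ _ _ h.2.2 h'.2.2 hthird ε hε

/-- The magnitude property does not depend on the compatible metric. -/
theorem IsMagnitude.abs_sub_le {Γ : Subgroup (M ≃ₜ M)} [d : MetricSpace (Bordification Γ)]
    (hd : IsCompatibleMetric Γ d) (hthird : ∀ x y : M, ∃ w, w ≠ x ∧ w ≠ y)
    {m₁ m₂ : M} (hm : m₁ ≠ m₂) {σ : Γ → M → ℝ} {N : Γ → ℝ} (hN : IsMagnitude Γ σ N) :
    ∀ ε > 0, ∃ C : ℝ, ∀ (x : M) (g : Γ), ε < dist (ofPoint Γ x) (g⁻¹ • ofGroup Γ 1) →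
      |σ g x - N g| ≤ C := by
  intro ε hε
  obtain ⟨d', hd', hN⟩ := hN
  obtain ⟨ε', hε', hlt⟩ := exists_dist_lt_of_isCompatibleMetric d d' hd hd' hthird hm hε
  obtain ⟨C, hC⟩ := IsMagnitudeFor.abs_sub_le hN ε' hε'
  exact ⟨C, fun x g hx => hC x g (hlt x g⁻¹ hx)⟩

/-- Coarse Patterson–Sullivan measures are shadow conformal. -/
theorem IsPattersonSullivanWith.isShadowConformal [MeasurableSpace M] [BorelSpace M]
    {Γ : Subgroup (M ≃ₜ M)} [MetricSpace (Bordification Γ)] {C δ : ℝ} {σ : Γ → M → ℝ} {N : Γ → ℝ}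
    {μ : Measure M} (hμ : IsPattersonSullivanWith Γ C σ δ μ)
    (hN : ∀ ε > 0, ∃ C : ℝ, ∀ (x : M) (g : Γ), ε < dist (ofPoint Γ x) (g⁻¹ • ofGroup Γ 1) →
      |σ g x - N g| ≤ C) :
    IsShadowConformal (ofPoint Γ) (ofGroup Γ 1) (expWeight δ N) μ := by
  refine ⟨fun g => Real.toNNReal_pos.2 (Real.exp_pos _), fun ε hε => ?_⟩
  have := hμ.isProbabilityMeasure
  obtain ⟨K, hK⟩ := hN ε hε
  -- C is the Patterson–Sullivan error, and |δ| * K comes from replacing σ g by N g on far points.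
  set D : ℝ := C + |δ| * K with hD
  refine ⟨(Real.exp D).toNNReal, fun g A hA hAf => ?_⟩
  set E : ℝ≥0 := (Real.exp D).toNNReal with hE
  have hEc : (E : ℝ≥0∞) = ENNReal.ofReal (Real.exp D) := rfl
  have hwc : (expWeight δ N g : ℝ≥0∞) = ENNReal.ofReal (Real.exp (-δ * N g)) := rfl
  have hmeas : Measurable (homeoAct Γ g⁻¹) := (g⁻¹ : Γ).1.continuous.measurable
  have hmap : μ.map (homeoAct Γ g⁻¹) A = μ ((fun x => g⁻¹ • x) ⁻¹' A) := Measure.map_apply hmeas hA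
  have : IsProbabilityMeasure (μ.map (homeoAct Γ g⁻¹)) :=
    Measure.isProbabilityMeasure_map hmeas.aemeasurable
  have hint : μ ((fun x => g⁻¹ • x) ⁻¹' A) = ∫⁻ x in A, (μ.map (homeoAct Γ g⁻¹)).rnDeriv μ x ∂μ := by
    rw [Measure.setLIntegral_rnDeriv (hμ.map_ac g⁻¹), hmap]
  have hbd := hμ.rnDeriv_bounds g⁻¹
  simp only [inv_inv] at hbd
  have hσ : ∀ x ∈ A, -δ * N g - D ≤ -C - δ * σ g x ∧ C - δ * σ g x ≤ D + -δ * N g := by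
    intro x hx
    have h1 : |δ * (σ g x - N g)| ≤ |δ| * K := by
      rw [abs_mul]
      gcongr
      exact hK x g (hAf hx)
    have h2 := abs_le.1 h1
    constructor <;> linarith [h2.1, h2.2]
  constructor
  · rw [hint, hEc, hwc, ← ENNReal.ofReal_mul (Real.exp_pos _).le, ← Real.exp_add,
      ← setLIntegral_const]
    refine setLIntegral_mono_ae measurable_const.aemeasurable ?_
    filter_upwards [hbd] with x hx hxA
    exact hx.2.trans (ENNReal.ofReal_le_ofReal (Real.exp_le_exp.2 (hσ x hxA).2))
  · have h1 : ENNReal.ofReal (Real.exp (-δ * N g - D)) * μ A ≤ μ ((fun x => g⁻¹ • x) ⁻¹' A) := by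
      rw [hint, ← setLIntegral_const]
      refine setLIntegral_mono_ae (Measure.measurable_rnDeriv _ _).aemeasurable ?_
      filter_upwards [hbd] with x hx hxA
      exact (ENNReal.ofReal_le_ofReal (Real.exp_le_exp.2 (hσ x hxA).1)).trans hx.1
    calc (expWeight δ N g : ℝ≥0∞) * μ A
        = E * (ENNReal.ofReal (Real.exp (-δ * N g - D)) * μ A) := by
          rw [← mul_assoc, hEc, ← ENNReal.ofReal_mul (Real.exp_pos _).le, ← Real.exp_add,
            add_sub_cancel, hwc]
      _ ≤ _ := by gcongr

end

/-! ### Comparison of weights and conclusion -/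

/-- Two comparable shadow conformal measures have comparable weights. -/
theorem exists_abs_sub_le_of_le_smul {G M B : Type*} [Group G] [MulAction G M] [MulAction G B]
    [TopologicalSpace M] [CompactSpace M] [MetricSpace B] [CompactSpace B]
    [ContinuousConstSMul G B] [MeasurableSpace M] [BorelSpace M] {p : M → B} {o : B}
    (h : IsConvBord (G := G) p o) (hfix : ∀ x : M, ∃ a : G, a • x ≠ x) {δ₁ δ₂ : ℝ} {N₁ N₂ : G → ℝ}
    {μ ν : Measure M} [IsFiniteMeasure μ] [IsFiniteMeasure ν] (hμ0 : μ ≠ 0)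
    (hμ : IsShadowConformal p o (expWeight δ₁ N₁) μ) (hν : IsShadowConformal p o (expWeight δ₂ N₂) ν)
    {C : ℝ≥0} (hC : μ ≤ C • ν) : ∃ K : ℝ, ∀ g, δ₂ * N₂ g - δ₁ * N₁ g ≤ K := by
  -- The lower shadow bound for μ and the upper one for ν bracket the mass of one shadow.
  obtain ⟨ε, hε, hsh⟩ := hμ.exists_le_measure_shadow h hμ0 hfix
  obtain ⟨C₁, hC₁⟩ := hsh ε hε le_rfl
  obtain ⟨C₂, hC₂⟩ := hν.exists_measure_shadow_le h hε
  refine ⟨Real.log (C₁ * C * C₂), fun g => ?_⟩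
  have h1 : (expWeight δ₁ N₁ g : ℝ≥0∞) ≤ (C₁ * C * C₂ * expWeight δ₂ N₂ g : ℝ≥0) := by
    calc (expWeight δ₁ N₁ g : ℝ≥0∞) ≤ C₁ * (C * (C₂ * expWeight δ₂ N₂ g)) := by
          refine (hC₁ g).trans ?_
          gcongr
          refine (hC _).trans ?_
          rw [Measure.smul_apply, ENNReal.smul_def, smul_eq_mul]
          gcongr
          exact hC₂ g
      _ = _ := by push_cast; ring
  have h2 : expWeight δ₁ N₁ g ≤ C₁ * C * C₂ * expWeight δ₂ N₂ g := by exact_mod_cast h1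
  have h3 : Real.exp (-δ₁ * N₁ g) ≤ (C₁ * C * C₂ : ℝ≥0) * Real.exp (-δ₂ * N₂ g) := by
    rw [← coe_expWeight, ← coe_expWeight]
    exact_mod_cast h2
  have hpos : (0 : ℝ) < (C₁ * C * C₂ : ℝ≥0) := by
    by_contra hle
    have h4 := Real.exp_pos (-δ₁ * N₁ g)
    have h5 := Real.exp_pos (-δ₂ * N₂ g)
    nlinarith
  rw [← Real.exp_log hpos, ← Real.exp_add] at h3
  have h4 := Real.exp_le_exp.1 h3
  push_cast at h4
  linarith

end ConvBord

open ConvBord in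
theorem proposition1p5 {M : Type*} [TopologicalSpace M] [CompactSpace M]
    [TopologicalSpace.MetrizableSpace M] [MeasurableSpace M] [BorelSpace M]
    (Γ : Subgroup (M ≃ₜ M)) (hΓ : IsConvergenceGroup Γ) (hne : IsNonElementary Γ)
    (σ₁ σ₂ : Γ → M → ℝ) (hσ₁ : IsExpanding Γ σ₁) (hσ₂ : IsExpanding Γ σ₂)
    (N₁ N₂ : Γ → ℝ) (hN₁ : IsMagnitude Γ σ₁ N₁) (hN₂ : IsMagnitude Γ σ₂ N₂)
    (δ₁ δ₂ : ℝ) (μ₁ μ₂ : Measure M)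
    (hμ₁ : IsCoarsePattersonSullivan Γ σ₁ δ₁ μ₁) (hμ₂ : IsCoarsePattersonSullivan Γ σ₂ δ₂ μ₂)
    (hdiv : poincareSeries Γ N₁ δ₁ = ∞) :
    Xor (μ₁ ⟂ₘ μ₂) (μ₁ ≪ μ₂ ∧ μ₂ ≪ μ₁) ∧
    List.TFAE [
      μ₁ ≪ μ₂,
      μ₁ ≪ μ₂ ∧ μ₂ ≪ μ₁,
      BddAbove (Set.range fun γ : Γ => |δ₁ * N₁ γ - δ₂ * N₂ γ|),
      ∃ C : ℝ≥0, 0 < C ∧ C⁻¹ • μ₁ ≤ μ₂ ∧ μ₂ ≤ C • μ₁] := by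
  obtain ⟨t, htΛ, ht⟩ := Set.exists_subset_encard_eq hne
  obtain ⟨x₁, x₂, x₃, h12, h13, h23, rfl⟩ := Set.encard_eq_three.1 ht
  have hthird : ∀ x y : M, ∃ w, w ≠ x ∧ w ≠ y := by
    intro x y
    by_contra! hcon
    by_cases e1 : x₁ = x
    · have e2 := hcon x₂ (fun e => h12 (e1.trans e.symm))
      have e3 := hcon x₃ (fun e => h13 (e1.trans e.symm))
      exact h23 (e2.trans e3.symm)
    · have e2 := hcon x₁ e1
      by_cases e3 : x₂ = x
      · exact h13 (e2.trans (hcon x₃ (fun e => h23 (e3.trans e.symm))).symm)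
      · exact h12 (e2.trans (hcon x₂ e3).symm)
  obtain ⟨⟨κ, -, hκ⟩, d, hd, hprop, -⟩ := hσ₁
  let _ := d
  obtain ⟨i1, i2, h⟩ := isConvBord_of_isCompatibleMetric Γ hd h12
  have hfix : ∀ x : M, ∃ a : Γ, a • x ≠ x := by
    refine h.exists_smul_ne h12 h13 h23 fun x hx => ?_
    exact exists_tendsto_of_mem_limitSet h hthird (htΛ (by simpa using hx))
  have hmag₁ := IsMagnitude.abs_sub_le hd hthird h12 hN₁
  have hmag₂ := IsMagnitude.abs_sub_le hd hthird h12 hN₂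
  have hN : IsProperMagnitude (ofPoint Γ) (ofGroup Γ 1) σ₁ N₁ :=
    h.isProperMagnitude hfix hthird ⟨κ, hκ.cocycle⟩ hmag₁ fun γ a b hγ hlox hc =>
      hprop γ a b hγ (fun n => (hlox n).isLoxodromic h) hc
  obtain ⟨C₁, hC₁⟩ := hμ₁
  obtain ⟨C₂, hC₂⟩ := hμ₂
  have := hC₁.isProbabilityMeasure
  have := hC₂.isProbabilityMeasure
  have hc₁ := IsPattersonSullivanWith.isShadowConformal hC₁ hmag₁
  have hc₂ := IsPattersonSullivanWith.isShadowConformal hC₂ hmag₂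
  have h10 : μ₁ ≠ 0 := IsProbabilityMeasure.ne_zero μ₁
  have h20 : μ₂ ≠ 0 := IsProbabilityMeasure.ne_zero μ₂
  have hns : ¬ Summable fun g : Γ => Real.exp (-δ₁ * N₁ g) := by
    intro hs
    have := hs.tsum_ofReal_ne_top
    exact this hdiv
  have hcon : μ₁ (conicalSet Γ (ofPoint Γ) (ofGroup Γ 1))ᶜ = 0 :=
    hN.measure_compl_conicalSet h hc₁ hfix hns
  -- The zooming argument is symmetric in the two measures and needs only one of them to live on the
  -- conical set, so it gives both inequalities.
  have hdom : ¬ μ₁ ⟂ₘ μ₂ → ∃ C : ℝ≥0, 0 < C ∧ C⁻¹ • μ₁ ≤ μ₂ ∧ μ₂ ≤ C • μ₁ := by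
    intro hnot
    obtain ⟨A, hA⟩ := hN.exists_le_smul h hc₁ hc₂ hfix hnot (Or.inl hcon)
    obtain ⟨A', hA'⟩ := hN.exists_le_smul h hc₂ hc₁ hfix (fun hs => hnot hs.symm) (Or.inr hcon)
    have hle : ∀ {c c' : ℝ≥0} {μ : Measure M}, c ≤ c' → c • μ ≤ c' • μ := by
      intro c c' μ hcc s
      rw [Measure.smul_apply, Measure.smul_apply, ENNReal.smul_def, ENNReal.smul_def, smul_eq_mul,
        smul_eq_mul]
      gcongr
    have hpos : 0 < max 1 (max A A') := zero_lt_one.trans_le (le_max_left _ _)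
    refine ⟨max 1 (max A A'), hpos, ?_, hA.trans (hle ((le_max_left _ _).trans (le_max_right _ _)))⟩
    have h1 : μ₁ ≤ max 1 (max A A') • μ₂ :=
      hA'.trans (hle ((le_max_right _ _).trans (le_max_right _ _)))
    intro s
    rw [Measure.smul_apply, ENNReal.smul_def, smul_eq_mul, ENNReal.coe_inv hpos.ne']
    rw [ENNReal.inv_mul_le_iff (by exact_mod_cast hpos.ne') ENNReal.coe_ne_top]
    have h2 := h1 s
    rwa [Measure.smul_apply, ENNReal.smul_def, smul_eq_mul] at h2
  have hle₁ : ∀ {C : ℝ≥0}, 0 < C → C⁻¹ • μ₁ ≤ μ₂ → μ₁ ≤ C • μ₂ := by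
    intro C hC hle s
    have h2 := hle s
    rw [Measure.smul_apply, ENNReal.smul_def, smul_eq_mul, ENNReal.coe_inv hC.ne',
      ENNReal.inv_mul_le_iff (by exact_mod_cast hC.ne') ENNReal.coe_ne_top] at h2
    rwa [Measure.smul_apply, ENNReal.smul_def, smul_eq_mul]
  have hac : (∃ C : ℝ≥0, 0 < C ∧ C⁻¹ • μ₁ ≤ μ₂ ∧ μ₂ ≤ C • μ₁) → μ₁ ≪ μ₂ ∧ μ₂ ≪ μ₁ := by
    rintro ⟨C, hC, hl, hr⟩
    exact ⟨Measure.absolutelyContinuous_of_le_smul (hle₁ hC hl),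
      Measure.absolutelyContinuous_of_le_smul hr⟩
  have hnot : μ₁ ≪ μ₂ → ¬ μ₁ ⟂ₘ μ₂ := by
    intro hab hs
    exact h10 (Measure.eq_zero_of_absolutelyContinuous_of_mutuallySingular hab hs)
  refine ⟨?_, ?_⟩
  · by_cases hs : μ₁ ⟂ₘ μ₂
    · exact Or.inl ⟨hs, fun hab => hnot hab.1 hs⟩
    · exact Or.inr ⟨hac (hdom hs), hs⟩
  · tfae_have 1 → 4 := fun hab => hdom (hnot hab)
    tfae_have 4 → 2 := hac
    tfae_have 2 → 1 := And.left
    tfae_have 4 → 3 := by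
      rintro ⟨C, hC, hl, hr⟩
      obtain ⟨K, hK⟩ := exists_abs_sub_le_of_le_smul h hfix h10 hc₁ hc₂ (hle₁ hC hl)
      obtain ⟨K', hK'⟩ := exists_abs_sub_le_of_le_smul h hfix h20 hc₂ hc₁ hr
      refine ⟨max K K', ?_⟩
      rintro _ ⟨g, rfl⟩
      refine abs_le.2 ⟨?_, (hK' g).trans (le_max_right _ _)⟩
      have := hK g
      have := le_max_left K K'
      linarith
    tfae_have 3 → 1 := by
      rintro ⟨K, hK⟩
      have hKexp : ∀ g, expWeight δ₁ N₁ g ≤ (Real.exp K).toNNReal *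
          expWeight δ₂ N₂ g := by
        intro g
        rw [← NNReal.coe_le_coe, NNReal.coe_mul, coe_expWeight, coe_expWeight,
          Real.coe_toNNReal _ (Real.exp_pos _).le, ← Real.exp_add]
        refine Real.exp_le_exp.2 ?_
        have := (abs_le.1 (hK ⟨g, rfl⟩)).1
        linarith
      exact hN.absolutelyContinuous h hc₁ hc₂ h20 hfix hKexp hcon
    tfae_finish
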